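/- **Set-up.** Let $K$ be a number field with algebraic closure $\bar K$, $\mathcal C$ an absolutely irreducible smooth projective curve over $K$, $x\in K(\mathcal C)$ a non-constant function and $y\in K(\mathcal C)$ such that $K(\mathcal C)=K(x,y)$. Let $\phi:\tilde{\mathcal C}\to\mathcal C$ be a covering, defined over $K$, by a smooth irreducible projective curve $\tilde{\mathcal C}$ over $K$. Regard $K(\mathcal C)$ as a subfield of $K(\tilde{\mathcal C})$ (so $x=x\circ\phi$), and let $\tilde y\in K(\tilde{\mathcal C})$ satisfy $K(\tilde{\mathcal C})=K(x,\tilde y)$. Let $f(X,Y)=f_0(X)Y^n+\dots+f_n(X)\in K[X,Y]$ be the irreducible polynomial of $Y$-degree $n$ with $f(x,y)=0$, normalized so that $f_0$ is monic. **Places.** Absolute values of $K$ and $\bar K$ are normalized to extend the standard ones of $\mathbb Q$; $M_K$ is the set of places of $K$ and $M_K^0$ the set of its finite places; $\bar v\mid v$ means that $\bar v$ is an extension of $v$ to $\bar K$. **Puiseux expansions and proximity.** For $Q\in\mathcal C(\bar K)$, not a pole of $x$, put $\alpha=x(Q)$, let $e_Q=\operatorname{ord}_Q(x-\alpha)$,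 let $\zeta$ be a primitive $e_Q$-th root of unity, and let $$y_i^{(Q)}=\sum_{k\ge -k_0}a_k^{(Q)}\zeta^{ik}(x-\alpha)^{k/e_Q}\qquad(0\le i<e_Q)$$ be the Puiseux expansions of $y$ at $Q$. Let $P\in\mathcal C(\bar K)$ be not a pole of $x$, put $\xi=x(P)$, and let $\bar v$ be a finite place of $\bar K$. The point $P$ is *$\bar v$-adically close* to $Q$ if $|\xi-\alpha|_{\bar v}<1$, and if, for a fixed $e_Q$-th root $\tau$ of $\xi-\alpha$, all the $e_Q$ series $\sum_k a_k^{(Q)}(\zeta^i\tau)^k$ converge $\bar v$-adically and one of their sums equals $y(P)$. **Exceptional sets.** Let $R(X)$ be the $Y$-resultant of $f$ and $f'_Y$, $r_0$ its leading coefficient, $\hat R(X)=r_0\prod(X-\alpha)$ the product over the distinct roots $\alpha$ of $R$ in $\bar K$, and $\Delta$ the resultant of $\hat R$ and $\hat R'$. Let $\mathcal Q$ be the set of points $Q\in\mathcal C(\bar K)$, not poles of $x$, such that $R(x(Q))=0$. For $Q\in\mathcal Q$ let $K^{(Q)}$ be the field generated over $K$ by $x(Q)$ and all the $a_k^{(Q)}$,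 and for a prime $q\mid e_Q$ let $a^{(Q)}(q)=a_\kappa^{(Q)}$, where $\kappa$ is the smallest $k$ with $q\nmid k$ and $a_k^{(Q)}\ne0$. Let $T=T_1\cup\dots\cup T_7$, where the $T_i$ consist of the $v\in M_K^0$ such that, respectively: 1. the prime below $v$ is at most $n$; 2. some coefficient of $f$ has absolute value $>1$ at $v$; 3. $|r_0|_v<1$; 4. $|\Delta|_v<1$; 5. $|a_k^{(Q)}|_{\bar v}>1$ for some $Q\in\mathcal Q$, some $k$ and some $\bar v\mid v$; 6. $v$ ramifies in $K^{(Q)}$ for some $Q\in\mathcal Q$; 7. $|a^{(Q)}(q)|_{\bar v}<1$ for some $Q\in\mathcal Q$, some prime $q\mid e_Q$ and some $\bar v\mid v$. (The expansion of $y$ at $Q$ may be any of the $e_Q$ ones; $T$ does not depend on this choice.) Define $\tilde f$, $\tilde R$, $\tilde{\mathcal Q}$, $\tilde T$ and the notion of proximity on $\tilde{\mathcal C}$ in the same way, from $x$ and $\tilde y$. Write $\tilde R=\tilde R_1\tilde R_2$, where all roots of $\tilde R_1$ are roots of $f_0$, and $\tilde R_2$ is monic and has no common root with $f_0$. Let $\Theta$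 be the resultant of $f_0$ and $\tilde R_2$, and let $U=\{v\in M_K:|\Theta|_v<1\}$. **Proposition.** Let $P\in\mathcal C(\bar K)$ be semi-defined over $K$, that is, $P$ is not a pole of $x$ and $\xi=x(P)\in K$. Let $\tilde P\in\tilde{\mathcal C}(\bar K)$ satisfy $\phi(\tilde P)=P$. Let $v$ be a finite place of $K$ and $\bar v$ an extension of $v$ to $\bar K$. Assume that $\tilde P$ is $\bar v$-adically close to some $\tilde Q\in\tilde{\mathcal Q}$ with $x(\tilde Q)\ne\xi$ (the last condition holds, for instance, whenever $\tilde P\notin\tilde{\mathcal Q}$). Then at least one of the following holds: * $|\xi|_v>1$; * $v\in T\cup\tilde T\cup U$; * $P$ is $\bar v$-adically close to the point $Q=\phi(\tilde Q)$. -/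

import Mathlib

/-!
Smooth projective curves over a number field `K` are represented by their function fields, and
their geometric points by places of the function field with values in an algebraic closure.
-/

noncomputable section

namespace CurveProximity

/-! ### Curves, points, coverings -/

/-- `F` is the function field of a smooth projective irreducible curve over `K`: it is finitely
generated over `K`, of transcendence degree one. -/
class IsCurveFunctionField (K F : Type*) [Field K] [Field F] [Algebra K F] : Prop where
  essFiniteType : Algebra.EssFiniteType K F
  trdeg_eq_one : Algebra.trdeg K F = 1

/-- The curve over `K` with function field `F` is absolutely irreducible: the base change of its
generic point to the algebraic closure `Kbar` of `K` is integral. -/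
def IsAbsolutelyIrreducible (K Kbar F : Type*) [Field K] [Field Kbar] [Field F] [Algebra K Kbar]
    [Algebra K F] : Prop :=
  IsDomain (TensorProduct K Kbar F)

/-- A `Kbar`-point of the smooth projective curve over `K` with function field `F`: the local ring
of the underlying closed point (a non-trivial valuation ring of `F` containing `K`), together with
the evaluation homomorphism over `K` from this local ring to `Kbar`. -/
structure CurvePoint (K F Kbar : Type*) [Field K] [Field F] [Field Kbar] [Algebra K F]
    [Algebra K Kbar] where
  /-- the functions which are regular at the point -/
  localRing : Subalgebra K F
  mem_or_inv_mem : ∀ g : F, g ∈ localRing ∨ g⁻¹ ∈ localRing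
  ne_top : localRing ≠ ⊤
  /-- the value at the point -/
  eval : localRing →ₐ[K] Kbar

/-- The function `g` is regular at `P` (it has no pole there) and takes the value `c`. -/
def CurvePoint.HasValue {K F Kbar : Type*} [Field K] [Field F] [Field Kbar] [Algebra K F]
    [Algebra K Kbar] (P : CurvePoint K F Kbar) (g : F) (c : Kbar) : Prop :=
  ∃ h : g ∈ P.localRing, P.eval ⟨g, h⟩ = c

/-- The image of a point under the covering of curves that corresponds to the extension `Ft / F`
of function fields (the point which lies below the given one): a function on the base is regular
at the image point when its pull-back is regular, and has the same value. -/
def CurvePoint.below {K Ft Kbar : Type*} (F : Type*) [Field K] [Field F] [Field Ft] [Field Kbar]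
    [Algebra K F] [Algebra K Ft] [Algebra F Ft] [IsScalarTower K F Ft] [FiniteDimensional F Ft]
    [Algebra K Kbar] (P : CurvePoint K Ft Kbar) : CurvePoint K F Kbar where
  localRing := P.localRing.comap (IsScalarTower.toAlgHom K F Ft)
  mem_or_inv_mem := fun g => by
    simpa [Subalgebra.mem_comap] using P.mem_or_inv_mem (algebraMap F Ft g)
  ne_top := by
    intro htop
    apply P.ne_top
    have hF : ∀ a : F, algebraMap F Ft a ∈ P.localRing := by
      intro a
      have ha : a ∈ P.localRing.comap (IsScalarTower.toAlgHom K F Ft) := by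
        rw [htop]; exact Algebra.mem_top
      simpa [Subalgebra.mem_comap] using ha
    let O : ValuationSubring Ft :=
      { P.localRing.toSubring with mem_or_inv_mem' := P.mem_or_inv_mem }
    have hmem : ∀ z : Ft, z ∈ O ↔ z ∈ P.localRing := fun z => Iff.rfl
    rw [eq_top_iff]
    intro z _
    have hz : IsIntegral F z := Algebra.IsIntegral.isIntegral z
    obtain ⟨p, hp, hpz⟩ := hz
    let φ : F →+* O :=
      (algebraMap F Ft).codRestrict O.toSubring (fun a => (hmem _).2 (hF a))
    have hzO : IsIntegral O z := by
      refine ⟨p.map φ, hp.map φ, ?_⟩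
      rw [Polynomial.eval₂_map]
      exact hpz
    obtain ⟨w, hw⟩ := IsIntegrallyClosed.isIntegral_iff.mp hzO
    rw [← hmem, ← hw]
    exact w.2
  eval := P.eval.comp
    (((IsScalarTower.toAlgHom K F Ft).comp (Subalgebra.val _)).codRestrict P.localRing
      (fun g => g.2))

/-! ### Places -/

/-- A finite place of a field which is algebraic over the rationals, normalized so that its
restriction to the rationals is the standard `p`-adic absolute value for some prime `p`. -/
def IsFinitePlace {L : Type*} [Field L] (v : AbsoluteValue L ℝ) : Prop :=
  IsNonarchimedean v ∧ ∃ p : ℕ, p.Prime ∧ v (p : L) = (p : ℝ)⁻¹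

/-- An infinite place, with its standard normalization. -/
def IsInfinitePlace {L : Type*} [Field L] (v : AbsoluteValue L ℝ) : Prop :=
  ∃ φ : L →+* ℂ, ∀ a : L, v a = ‖φ a‖

/-- The absolute value `w` extends the absolute value `v`. -/
def Extends {K L : Type*} [Field K] [Field L] [Algebra K L] (w : AbsoluteValue L ℝ)
    (v : AbsoluteValue K ℝ) : Prop :=
  ∀ a : K, w (algebraMap K L a) = v a

/-- The finite place `v` ramifies in `L`: for some extension `w` of `v` to `L` the value group
of `w` is strictly larger than that of `v`, that is, the ramification index of `w` over `v`
exceeds one. -/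
def RamifiesIn {K : Type*} [Field K] (v : AbsoluteValue K ℝ) (L : Type*) [Field L]
    [Algebra K L] : Prop :=
  ∃ w : AbsoluteValue L ℝ, Extends w v ∧ ∃ b : L, ∀ a : K, w b ≠ v a

/-! ### Puiseux expansions and proximity -/

section Puiseux

variable {K F Kbar : Type*} [Field K] [Field F] [Field Kbar] [Algebra K F] [Algebra K Kbar]

/-- `σ` expands the rational functions into Laurent series at the point `Q` in the variable
`t = (x - x(Q))^(1/e)`, where `e` is the ramification index of `x` at `Q`. In detail: `σ` is an
embedding of fields over `K`; functions regular at `Q` expand into power series in `t` with the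
constant term equal to the value at `Q`; `t` is a local parameter at `Q` (some function on the curve has order exactly one in `t`);
and `x - x(Q) = t ^ e`. Thus the order of `x - x(Q)` at `Q` is `e`, and `(σ y).coeff k` is the
coefficient of `(x - x(Q))^(k/e)` in the Puiseux expansion of `y`. -/
def IsPuiseuxExpansion (x : F) (Q : CurvePoint K F Kbar) (e : ℕ)
    (σ : F →+* LaurentSeries Kbar) : Prop :=
  0 < e ∧
  (∀ c : K, σ (algebraMap K F c) = HahnSeries.C (algebraMap K Kbar c)) ∧
  (∀ g : Q.localRing, ∃ s : PowerSeries Kbar,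
    σ g = HahnSeries.ofPowerSeries ℤ Kbar s ∧ PowerSeries.constantCoeff s = Q.eval g) ∧
  (∃ g : F, (σ g).order = 1) ∧
  ∃ α : Kbar, Q.HasValue x α ∧ σ x = HahnSeries.C α + HahnSeries.single (e : ℤ) (1 : Kbar)

/-- The partial sums (of the terms of degree less than `N`) of the Laurent series `s` at `τ`. -/
def partialSum (s : LaurentSeries Kbar) (τ : Kbar) (N : ℕ) : Kbar :=
  ∑ k ∈ Finset.Ico s.order (N : ℤ), s.coeff k * τ ^ k

/-- The Laurent series `s` converges at `τ` to the sum `c` with respect to `vbar`. At `τ = 0` the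
series makes sense only when it has no terms of negative degree. -/
def SumsTo (vbar : AbsoluteValue Kbar ℝ) (s : LaurentSeries Kbar) (τ c : Kbar) : Prop :=
  (τ = 0 → ∀ k : ℤ, k < 0 → s.coeff k = 0) ∧
  Filter.Tendsto (fun N : ℕ => vbar (partialSum s τ N - c)) Filter.atTop (nhds 0)

/-- The point `P` is `vbar`-adically close to the point `Q` (with respect to the functions `x`
and `y`): both are not poles of `x`, `|x(P) - x(Q)| < 1`, the `e` Puiseux expansions of `y` at `Q`
(obtained from one of them by replacing `t` by `ζ ^ i * t`, where `ζ` is a primitive `e`-th root of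
unity) converge at `x(P)`, and one of the sums is equal to `y(P)`. Here `τ` is a fixed `e`-th root
of `x(P) - x(Q)`. -/
def IsClose (vbar : AbsoluteValue Kbar ℝ) (x y : F) (P Q : CurvePoint K F Kbar) : Prop :=
  ∃ ξ α : Kbar, P.HasValue x ξ ∧ Q.HasValue x α ∧ vbar (ξ - α) < 1 ∧
    ∃ (e : ℕ) (σ : F →+* LaurentSeries Kbar) (ζ τ : Kbar),
      IsPuiseuxExpansion x Q e σ ∧ IsPrimitiveRoot ζ e ∧ τ ^ e = ξ - α ∧
      (∀ i < e, ∃ c : Kbar, SumsTo vbar (σ y) (ζ ^ i * τ) c) ∧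
      ∃ i < e, ∃ η : Kbar, P.HasValue y η ∧ SumsTo vbar (σ y) (ζ ^ i * τ) η

end Puiseux

/-! ### The defining polynomial, its resultant, and the exceptional sets of places

A polynomial in `X` and `Y` is an element of `Polynomial (Polynomial K)`, with `Y` as the outer
variable; thus `f.leadingCoeff` is the coefficient `f₀(X)` of the highest power of `Y`, and
`f.natDegree` is the degree in `Y`. -/

section Exceptional

variable {K F : Type*} (Kbar : Type*) [Field K] [Field F] [Field Kbar] [Algebra K F]
  [Algebra K Kbar]

/-- `f` is the irreducible polynomial with `f(x, y) = 0`, normalized so that the coefficient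
`f₀(X)` of the highest power of `Y` is monic. -/
def IsDefiningPolynomial (x y : F) (f : Polynomial (Polynomial K)) : Prop :=
  Irreducible f ∧ Polynomial.aevalAeval x y f = 0 ∧ f.leadingCoeff.Monic

/-- The `Y`-resultant `R(X)` of `f` and of its derivative with respect to `Y`. -/
def resultantY (f : Polynomial (Polynomial K)) : Polynomial K :=
  Polynomial.resultant f (Polynomial.derivative f)

open Classical in
/-- The radical of a polynomial: the separable polynomial with the same roots and the same leading
coefficient. (`UniqueFactorizationMonoid.radical` is the product of the distinct monic irreducible
factors.) -/
def polyRadical (g : Polynomial K) : Polynomial K :=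
  Polynomial.C g.leadingCoeff * UniqueFactorizationMonoid.radical g

/-- The set of points `Q`, not poles of `x`, for which `x(Q)` is a root of `R(X)`. -/
def criticalPoints (x : F) (f : Polynomial (Polynomial K)) : Set (CurvePoint K F Kbar) :=
  {Q | ∃ α : Kbar, Q.HasValue x α ∧ Polynomial.aeval α (resultantY f) = 0}

def T₁ (f : Polynomial (Polynomial K)) : Set (AbsoluteValue K ℝ) :=
  {v | IsFinitePlace v ∧ ∃ p : ℕ, p.Prime ∧ v (p : K) < 1 ∧ p ≤ f.natDegree}

def T₂ (f : Polynomial (Polynomial K)) : Set (AbsoluteValue K ℝ) :=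
  {v | IsFinitePlace v ∧ ∃ i j : ℕ, 1 < v ((f.coeff i).coeff j)}

def T₃ (f : Polynomial (Polynomial K)) : Set (AbsoluteValue K ℝ) :=
  {v | IsFinitePlace v ∧ v (resultantY f).leadingCoeff < 1}

def T₄ (f : Polynomial (Polynomial K)) : Set (AbsoluteValue K ℝ) :=
  {v | IsFinitePlace v ∧
    v (Polynomial.resultant (polyRadical (resultantY f))
      (Polynomial.derivative (polyRadical (resultantY f)))) < 1}

def T₅ (x y : F) (f : Polynomial (Polynomial K)) : Set (AbsoluteValue K ℝ) :=
  {v | IsFinitePlace v ∧ ∃ Q ∈ criticalPoints Kbar x f,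
    ∃ (e : ℕ) (σ : F →+* LaurentSeries Kbar), IsPuiseuxExpansion x Q e σ ∧
      ∃ (k : ℤ) (vbar : AbsoluteValue Kbar ℝ), Extends vbar v ∧ 1 < vbar ((σ y).coeff k)}

/-- The field generated over `K` by `α` and by the coefficients of the Laurent series `s`. -/
def coeffField (α : Kbar) (s : LaurentSeries Kbar) : IntermediateField K Kbar :=
  IntermediateField.adjoin K (insert α (Set.range s.coeff))

def T₆ (x y : F) (f : Polynomial (Polynomial K)) : Set (AbsoluteValue K ℝ) :=
  {v | IsFinitePlace v ∧ ∃ Q ∈ criticalPoints Kbar x f,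
    ∃ (e : ℕ) (σ : F →+* LaurentSeries Kbar), IsPuiseuxExpansion x Q e σ ∧
      ∃ α : Kbar, Q.HasValue x α ∧ RamifiesIn v (coeffField (K := K) Kbar α (σ y))}

variable {Kbar} in
/-- `a` is the `q`-essential coefficient of the series `s`: the coefficient with the smallest
index not divisible by `q` among the non-zero ones. -/
def IsEssentialCoeff (s : LaurentSeries Kbar) (q : ℕ) (a : Kbar) : Prop :=
  ∃ κ : ℤ, ¬ (q : ℤ) ∣ κ ∧ s.coeff κ = a ∧ a ≠ 0 ∧
    ∀ k : ℤ, k < κ → ¬ (q : ℤ) ∣ k → s.coeff k = 0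

def T₇ (x y : F) (f : Polynomial (Polynomial K)) : Set (AbsoluteValue K ℝ) :=
  {v | IsFinitePlace v ∧ ∃ Q ∈ criticalPoints Kbar x f,
    ∃ (e : ℕ) (σ : F →+* LaurentSeries Kbar), IsPuiseuxExpansion x Q e σ ∧
      ∃ (q : ℕ) (a : Kbar) (vbar : AbsoluteValue Kbar ℝ), q.Prime ∧ q ∣ e ∧
        IsEssentialCoeff (σ y) q a ∧ Extends vbar v ∧ vbar a < 1}

/-- The union of the seven exceptional sets attached to a curve with the functions `x`, `y`. -/
def exceptionalPlaces (x y : F) (f : Polynomial (Polynomial K)) : Set (AbsoluteValue K ℝ) :=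
  T₁ f ∪ T₂ f ∪ T₃ f ∪ T₄ f ∪ T₅ Kbar x y f ∪ T₆ Kbar x y f ∪ T₇ Kbar x y f

/-- Factor the resultant `R` attached to `ft` as `R₁ * R₂`, where all roots of `R₁` are roots of
`f₀`, and `R₂` is monic without common roots with `f₀`; the set consists of the places at which
the resultant of `f₀` and `R₂` has absolute value less than one. -/
def towerPlaces (f ft : Polynomial (Polynomial K)) : Set (AbsoluteValue K ℝ) :=
  {v | (IsFinitePlace v ∨ IsInfinitePlace v) ∧ ∃ R₁ R₂ : Polynomial K,
    resultantY ft = R₁ * R₂ ∧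
    (∀ α : Kbar, Polynomial.aeval α R₁ = 0 → Polynomial.aeval α f.leadingCoeff = 0) ∧
    (∀ α : Kbar, Polynomial.aeval α R₂ = 0 → Polynomial.aeval α f.leadingCoeff ≠ 0) ∧
    R₂.Monic ∧ v (Polynomial.resultant f.leadingCoeff R₂) < 1}

end Exceptional

end CurveProximity

end

open CurveProximity

noncomputable section

namespace CurveProximity

open Polynomial

/-! ### Denominators of functions on the covered curve -/

section Algebra

variable {K F : Type*} [Field K] [Field F] [Algebra K F]

/-! Pulled back to the covering curve, `y` has the form `A(x, ỹ) / B(x)`. Working modulo one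
irreducible polynomial at a time, every irreducible factor of `B` can be made to divide `f₀` or `R̃`
(`IsDefiningPolynomial.exists_denominator`). Let `α = x(Q̃)`. Outside the exceptional places, every
root of `B` other than `α` has distance at least one from `α`: two critical values of one curve are
kept apart by `T₂`, `T₃`, `T₄`, and a root of `f₀` is kept apart from a root of `R̃` by `U`.

Hence `B(α + t^e)` has a reciprocal with bounded coefficients, and outside `T₅` of the covering the
expansion of `ỹ` is bounded too. The field `Kbar` is not complete, so bounded series need not have
sums. "The sum at `τ` is `c`" is therefore replaced by "`s - c` is `t - τ` times a bounded series".
This is equivalent to convergence for bounded `s` and `0 < |τ| < 1`, and visibly compatible with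
sums and products. So the expansion of `y` in the parameter at `Q̃` converges at each `ζ^j τ`, and
the sum matching `ỹ(P̃)` is `A(ξ, ỹ(P̃)) / B(ξ) = y(P)`.

It remains to see that this expansion is a Puiseux expansion at `Q = φ(Q̃)` with `t^m` substituted
for `t`. The orders of the functions of `F` in `t` form a group `mℤ`, and a derivation argument
shows that all their expansions are series in `t^m` (`mem_range_expandLaurent_of_dvd_order`).
Replacing `ζ`, `τ` by `ζ^m`, `τ^m` gives the required proximity. The argument always yields one of
the last two alternatives. -/

lemma aevalAeval_eq_eval₂ (x y : F) (p : K[X][X]) :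
    aevalAeval x y p = eval₂ (aeval x : K[X] →ₐ[K] F).toRingHom y p := by
  induction p using Polynomial.induction_on' with
  | add p q hp hq => rw [map_add, hp, hq, eval₂_add]
  | monomial n a =>
    rw [← C_mul_X_pow_eq_monomial, map_mul, map_pow, aevalAeval_C, aevalAeval_Y]
    simp

lemma aeval_ne_zero_of_transcendental {x : F} (hx : Transcendental K x) {p : K[X]} (hp : p ≠ 0) :
    aeval x p ≠ 0 :=
  fun h => hp ((transcendental_iff.1 hx) p h)

lemma IsDefiningPolynomial.natDegree_pos {x y : F} (hx : Transcendental K x) {f : K[X][X]}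
    (hf : IsDefiningPolynomial x y f) : 0 < f.natDegree := by
  by_contra h
  obtain ⟨hirr, h0, -⟩ := hf
  rw [eq_C_of_natDegree_eq_zero (by omega : f.natDegree = 0), aevalAeval_C] at h0
  refine aeval_ne_zero_of_transcendental hx (fun h1 => hirr.ne_zero ?_) h0
  rw [eq_C_of_natDegree_eq_zero (by omega : f.natDegree = 0), h1, C_0]

/-- The defining polynomial generates the ideal of all relations between `x` and `y`. -/
lemma IsDefiningPolynomial.dvd {x y : F} (hx : Transcendental K x) {f : K[X][X]}
    (hf : IsDefiningPolynomial x y f) {g : K[X][X]} (hg : aevalAeval x y g = 0) : f ∣ g := by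
  have hpos := hf.natDegree_pos hx
  obtain ⟨hirr, h0, -⟩ := hf
  have hprim : f.IsPrimitive := hirr.isPrimitive hpos.ne'
  -- Gauss's lemma: it suffices to divide over `K(X)`, where `f` stays irreducible. Non-divisibility
  -- would give a Bezout identity, which reads `0 = 1` at `(x, y)`.
  refine hprim.dvd_of_fraction_map_dvd_fraction_map (K := FractionRing K[X]) ?_
  have hirr' := (hprim.irreducible_iff_irreducible_map_fraction_map (K := FractionRing K[X])).1 hirr
  have hinj : Function.Injective (aeval x : K[X] →ₐ[K] F).toRingHom :=
    transcendental_iff_injective.1 hx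
  let φ : FractionRing K[X] →+* F := IsFractionRing.lift hinj
  have hφ : φ.comp (algebraMap K[X] (FractionRing K[X])) = (aeval x : K[X] →ₐ[K] F).toRingHom := by
    exact RingHom.ext fun a => IsFractionRing.lift_algebraMap hinj a
  have key : ∀ p : K[X][X],
      eval₂ φ y (p.map (algebraMap K[X] (FractionRing K[X]))) = aevalAeval x y p := by
    intro p
    rw [eval₂_map, hφ, aevalAeval_eq_eval₂]
  by_contra hnd
  obtain ⟨u, w, huw⟩ := (hirr'.coprime_iff_not_dvd).2 hnd
  have := congrArg (eval₂ φ y) huw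
  rw [eval₂_add, eval₂_mul, eval₂_mul, key, key, h0, hg] at this
  simp at this

/-- Every function is a polynomial in `x` and `y` divided by a polynomial in `x`. -/
lemma IsDefiningPolynomial.exists_aeval_mul_eq {x y : F} (hx : Transcendental K x) {f : K[X][X]}
    (hf : IsDefiningPolynomial x y f) (hxy : IntermediateField.adjoin K {x, y} = ⊤) (z : F) :
    ∃ (B : K[X]) (A : K[X][X]), B ≠ 0 ∧ aeval x B * z = aevalAeval x y A := by
  let L := IntermediateField.adjoin K {x}
  have hyL : IsAlgebraic L y := by
    let φ : K[X] →+* L := (aeval (⟨x, IntermediateField.mem_adjoin_simple_self K x⟩ : L) :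
      K[X] →ₐ[K] L).toRingHom
    have hφ : (algebraMap L F).comp φ = (aeval x : K[X] →ₐ[K] F).toRingHom := by
      refine RingHom.ext fun a => ?_
      exact (aeval_algebraMap_apply F (⟨x, IntermediateField.mem_adjoin_simple_self K x⟩ : L)
        a).symm
    refine ⟨f.map φ, ?_, ?_⟩
    · rw [Ne, Polynomial.map_eq_zero_iff]
      · exact hf.1.ne_zero
      · have : Function.Injective ((algebraMap L F).comp φ) := by
          rw [hφ]; exact transcendental_iff_injective.1 hx
        exact Function.Injective.of_comp (f := algebraMap L F) (by simpa using this)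
    · rw [aeval_def, eval₂_map, hφ, ← aevalAeval_eq_eval₂, hf.2.1]
  -- As `y` is algebraic over `K(x)`, the field `K(x)(y)` is the ring `K(x)[y]`, so only
  -- denominators in `x` occur.
  have htop : z ∈ IntermediateField.adjoin L {y} := by
    have : z ∈ (IntermediateField.adjoin L {y}).restrictScalars K := by
      rw [IntermediateField.adjoin_simple_adjoin_simple, hxy]; trivial
    exact this
  rw [← IntermediateField.mem_toSubalgebra,
    IntermediateField.adjoin_simple_toSubalgebra_of_isAlgebraic hyL] at htop
  induction htop using Algebra.adjoin_induction with
  | mem a ha =>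
    rw [Set.mem_singleton_iff] at ha
    exact ⟨1, X, one_ne_zero, by rw [ha, aevalAeval_Y]; simp⟩
  | algebraMap a =>
    obtain ⟨r, s, hrs⟩ := (IntermediateField.mem_adjoin_simple_iff K _).1 a.2
    -- The quotient `r(x) / s(x)` may have `s = 0`; its value is then `0` by convention.
    by_cases hs : s = 0
    · refine ⟨1, 0, one_ne_zero, ?_⟩
      change _ * (a : F) = _
      rw [hrs, hs]; simp
    · refine ⟨s, C r, hs, ?_⟩
      change _ * (a : F) = _
      rw [hrs, aevalAeval_C, mul_div_cancel₀ _ (aeval_ne_zero_of_transcendental hx hs)]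
  | add a b _ _ ha hb =>
    obtain ⟨B, A, hB, h⟩ := ha
    obtain ⟨B', A', hB', h'⟩ := hb
    refine ⟨B * B', C B' * A + C B * A', mul_ne_zero hB hB', ?_⟩
    rw [map_add, map_mul (aevalAeval x y), map_mul (aevalAeval x y), aevalAeval_C, aevalAeval_C,
      ← h, ← h', map_mul]
    ring
  | mul a b _ _ ha hb =>
    obtain ⟨B, A, hB, h⟩ := ha
    obtain ⟨B', A', hB', h'⟩ := hb
    refine ⟨B * B', A * A', mul_ne_zero hB hB', ?_⟩
    rw [map_mul (aevalAeval x y), ← h, ← h', map_mul]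
    ring

/-- If the resultant of `f` and its derivative does not vanish modulo `M`, then `f` remains
separable modulo `M`. -/
lemma separable_map_of_resultantY {L : Type*} [Field L] (π : K[X] →+* L) {f : K[X][X]}
    (hf : 0 < f.natDegree) (hR : π (resultantY f) ≠ 0) : (f.map π).Separable := by
  -- `R` is a combination of `f` and `f'` over `K[X][Y]`; this identity survives `π`, and `π R` is
  -- invertible.
  obtain ⟨p, q, -, -, h⟩ := exists_mul_add_mul_eq_C_resultant f (derivative f) le_rfl le_rfl
    (Or.inl hf.ne')
  have h2 := congrArg (Polynomial.map π) h
  rw [Polynomial.map_add, Polynomial.map_mul, Polynomial.map_mul, Polynomial.map_C,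
    ← derivative_map] at h2
  refine (separable_def' _).2 ⟨C (π (resultantY f))⁻¹ * p.map π,
    C (π (resultantY f))⁻¹ * q.map π, ?_⟩
  calc _ = C (π (resultantY f))⁻¹ * (f.map π * p.map π + derivative (f.map π) * q.map π) := by ring
    _ = 1 := by
      rw [h2, ← C_mul]
      change C ((π (resultantY f))⁻¹ * π (resultantY f)) = 1
      rw [inv_mul_cancel₀ hR, C_1]

/-- A denominator of `z` may be divided by every irreducible polynomial at which `z` is integral
and the defining polynomial of `y` is separable. -/
lemma IsDefiningPolynomial.exists_aeval_mul_eq_of_mul {x y z : F} (hx : Transcendental K x)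
    {g : K[X][X]} (hg : IsDefiningPolynomial x y g) {f : K[X][X]} (hf : aevalAeval x z f = 0)
    {M B : K[X]} {A : K[X][X]} (hM : Irreducible M) (hMf : ¬ M ∣ f.leadingCoeff)
    (hMg : ¬ M ∣ resultantY g) (h : aeval x (M * B) * z = aevalAeval x y A) :
    ∃ D : K[X][X], aeval x B * z = aevalAeval x y D := by
  have := Fact.mk hM
  let π : K[X] →+* AdjoinRoot M := AdjoinRoot.mk M
  have hπ : ∀ p, π p = 0 ↔ M ∣ p := fun p => AdjoinRoot.mk_eq_zero
  -- `G = ∑ fᵢ (MB)^(n-i) A^i` is the relation `f(x, z) = 0` cleared of denominators by means of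
  -- `MBz = A`.
  let G : K[X][X] := eval₂ C A (f.scaleRoots (M * B))
  have hG : aevalAeval x y G = 0 := by
    have h1 : ((aevalAeval x y : K[X][X] →ₐ[K] F) : K[X][X] →+* F).comp C =
        (aeval x : K[X] →ₐ[K] F).toRingHom :=
      RingHom.ext fun a => aevalAeval_C x y a
    have h2 : aevalAeval x y G = eval₂ (aeval x : K[X] →ₐ[K] F).toRingHom (aevalAeval x y A)
        (f.scaleRoots (M * B)) := by
      rw [← h1]
      exact hom_eval₂ (f.scaleRoots (M * B)) C
        ((aevalAeval x y : K[X][X] →ₐ[K] F) : K[X][X] →+* F) A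
    rw [h2, ← h]
    exact scaleRoots_eval₂_eq_zero _ (by rw [← aevalAeval_eq_eval₂, hf])
  have hdvd : g.map π ∣ A.map π := by
    have hsep := separable_map_of_resultantY π (hg.natDegree_pos hx) (fun h0 => hMg ((hπ _).1 h0))
    have h1 : g.map π ∣ G.map π := Polynomial.map_dvd π (hg.dvd hx hG)
    -- Modulo `M` only the top term of `G` survives.
    have h2 : G.map π = C (π f.leadingCoeff) * (A.map π) ^ f.natDegree := by
      have h3 : (f.scaleRoots (M * B)).map π = C (π f.leadingCoeff) * X ^ f.natDegree := by
        ext i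
        rw [coeff_map, coeff_scaleRoots, coeff_C_mul, coeff_X_pow, map_mul, map_pow, map_mul,
          (hπ M).2 dvd_rfl, zero_mul]
        split_ifs with hi
        · simp [hi]
        · rcases lt_or_gt_of_ne hi with hlt | hgt
          · rw [zero_pow (by omega), mul_zero, mul_zero]
          · rw [coeff_eq_zero_of_natDegree_lt hgt]; simp
      have h4 : (mapRingHom π).comp C = (C : AdjoinRoot M →+* _).comp π :=
        RingHom.ext fun a => by simp
      have h5 : G.map π = eval₂ C (A.map π) ((f.scaleRoots (M * B)).map π) := by
        rw [eval₂_map, ← h4]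
        exact hom_eval₂ (f.scaleRoots (M * B)) C (mapRingHom π) A
      rw [h5, h3]
      simp
    rw [h2] at h1
    have hu : IsUnit (C (π f.leadingCoeff)) :=
      isUnit_C.2 (isUnit_iff_ne_zero.2 fun h0 => hMf ((hπ _).1 h0))
    -- A separable polynomial dividing a power of `A` divides `A`.
    exact hsep.squarefree.isRadical f.natDegree _ ((hu.dvd_mul_left).1 h1)
  obtain ⟨c, hc⟩ := hdvd
  obtain ⟨c, rfl⟩ := Polynomial.map_surjective π AdjoinRoot.mk_surjective c
  have h0 : C M ∣ A - g * c := by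
    rw [C_dvd_iff_dvd_coeff]
    intro i
    rw [← hπ, ← coeff_map, Polynomial.map_sub, Polynomial.map_mul, hc, sub_self, coeff_zero]
  -- `A = g c + M D` and `g(x, y) = 0`, so `M(x)` cancels.
  obtain ⟨D, hD⟩ := h0
  refine ⟨D, mul_left_cancel₀ (aeval_ne_zero_of_transcendental hx hM.ne_zero) ?_⟩
  have h1 := congrArg (aevalAeval x y) hD
  rw [map_sub, map_mul (aevalAeval x y), map_mul (aevalAeval x y), hg.2.1, zero_mul, sub_zero,
    aevalAeval_C] at h1
  rw [← h1, ← h, map_mul, mul_assoc]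

/-- The function `z` has a denominator all of whose roots are roots of the leading coefficient of
an equation for `z`, or critical values attached to `y`. -/
lemma IsDefiningPolynomial.exists_denominator {x y z : F} (hx : Transcendental K x)
    {g : K[X][X]} (hg : IsDefiningPolynomial x y g)
    (hxy : IntermediateField.adjoin K {x, y} = ⊤) {f : K[X][X]} (hf : aevalAeval x z f = 0) :
    ∃ (B : K[X]) (A : K[X][X]), B ≠ 0 ∧ aeval x B * z = aevalAeval x y A ∧
      ∀ M : K[X], Irreducible M → M ∣ B → M ∣ f.leadingCoeff ∨ M ∣ resultantY g := by
  obtain ⟨B, A, hB, h⟩ := hg.exists_aeval_mul_eq hx hxy z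
  induction hn : B.natDegree using Nat.strong_induction_on generalizing A B with
  | _ n ih =>
    by_cases hall : ∀ M : K[X], Irreducible M → M ∣ B → M ∣ f.leadingCoeff ∨ M ∣ resultantY g
    · exact ⟨B, A, hB, h, hall⟩
    · push Not at hall
      obtain ⟨M, hM, ⟨B', rfl⟩, h1, h2⟩ := hall
      obtain ⟨D, hD⟩ := hg.exists_aeval_mul_eq_of_mul hx hf hM h1 h2 h
      have hB' := right_ne_zero_of_mul hB
      refine ih _ ?_ B' D hB' hD rfl
      rw [← hn, natDegree_mul hM.ne_zero hB']
      have := hM.natDegree_pos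
      omega

end Algebra

/-! ### Laurent series: Euler derivation and substitution of powers -/

section Laurent

variable {L : Type*} [Field L]

/-- The Euler derivation `t * d/dt`, which multiplies the coefficient of `t ^ k` by `k`. -/
def eulerSeries (s : LaurentSeries L) : LaurentSeries L where
  coeff k := (k : L) * s.coeff k
  isPWO_support' := s.isPWO_support.mono fun k hk h0 => hk (by simp [h0])

lemma coeff_eulerSeries (s : LaurentSeries L) (k : ℤ) :
    (eulerSeries s).coeff k = (k : L) * s.coeff k := rfl

lemma support_eulerSeries_subset (s : LaurentSeries L) :
    (eulerSeries s).support ⊆ s.support := fun k hk h0 => hk (by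
  rw [coeff_eulerSeries, h0, mul_zero])

lemma eulerSeries_add (a b : LaurentSeries L) :
    eulerSeries (a + b) = eulerSeries a + eulerSeries b := by
  ext k
  simp only [coeff_eulerSeries, HahnSeries.coeff_add, mul_add]

lemma eulerSeries_mul (a b : LaurentSeries L) :
    eulerSeries (a * b) = a * eulerSeries b + eulerSeries a * b := by
  ext k
  rw [HahnSeries.coeff_add, coeff_eulerSeries,
    HahnSeries.coeff_mul_right' b.isPWO_support (support_eulerSeries_subset b),
    HahnSeries.coeff_mul_left' a.isPWO_support (support_eulerSeries_subset a),
    HahnSeries.coeff_mul, Finset.mul_sum, ← Finset.sum_add_distrib]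
  refine Finset.sum_congr rfl fun ij hij => ?_
  rw [← (Finset.mem_antidiagonal.1 hij).2.2, coeff_eulerSeries, coeff_eulerSeries]
  push_cast
  ring

lemma eulerSeries_C (c : L) : eulerSeries (HahnSeries.C c : LaurentSeries L) = 0 := by
  ext k
  rw [coeff_eulerSeries, HahnSeries.C_apply, HahnSeries.coeff_single]
  split_ifs with h <;> simp [h]

/-- Lower bounds for the supports are used instead of orders, so that zero series and vanishing
coefficients at `i`, `j` need no separate treatment. -/
lemma coeff_mul_of_vanish {a b : LaurentSeries L} {i j : ℤ} (ha : ∀ k < i, a.coeff k = 0)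
    (hb : ∀ k < j, b.coeff k = 0) : (∀ k < i + j, (a * b).coeff k = 0) ∧
      (a * b).coeff (i + j) = a.coeff i * b.coeff j := by
  constructor
  · intro k hk
    rw [HahnSeries.coeff_mul]
    refine Finset.sum_eq_zero fun p hp => ?_
    have hp := (Finset.mem_antidiagonal.1 hp).2.2
    rcases lt_or_ge p.1 i with h | h
    · rw [ha _ h, zero_mul]
    · rw [hb _ (by omega), mul_zero]
  · rw [HahnSeries.coeff_mul, Finset.sum_eq_single (i, j)]
    · intro p hp hne
      have hp := (Finset.mem_antidiagonal.1 hp).2.2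
      rcases lt_trichotomy p.1 i with h | h | h
      · rw [ha _ h, zero_mul]
      · exact absurd (Prod.ext h (by simp only; omega)) hne
      · rw [hb _ (by omega), mul_zero]
    · intro h
      simp only [Finset.mem_antidiagonal, HahnSeries.mem_support, and_true, not_and_or,
        not_not] at h
      rcases h with h | h
      · simp only [h, zero_mul]
      · simp only [h, mul_zero]

/-- The substitution `t ↦ t ^ m`. -/
def expandLaurent (m : ℕ) (hm : 0 < m) : LaurentSeries L →+* LaurentSeries L :=
  HahnSeries.embDomainRingHom (AddMonoidHom.mulLeft (m : ℤ))
    (fun _ _ h => mul_left_cancel₀ (by exact_mod_cast hm.ne') h)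
    (fun _ _ => mul_le_mul_iff_right₀ (by exact_mod_cast hm))

variable {m : ℕ} {hm : 0 < m}

lemma coeff_expandLaurent_mul (s : LaurentSeries L) (k : ℤ) :
    (expandLaurent m hm s).coeff (m * k) = s.coeff k :=
  HahnSeries.embDomain_coeff (a := k)

lemma coeff_expandLaurent_of_not_dvd (s : LaurentSeries L) {k : ℤ} (hk : ¬ (m : ℤ) ∣ k) :
    (expandLaurent m hm s).coeff k = 0 := by
  refine HahnSeries.embDomain_of_notMem_range ?_
  rintro ⟨j, rfl⟩
  exact hk ⟨j, rfl⟩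

lemma expandLaurent_injective : Function.Injective (expandLaurent m hm : LaurentSeries L →+* _) :=
  HahnSeries.embDomain_injective

lemma expandLaurent_C (c : L) : expandLaurent m hm (HahnSeries.C c) = HahnSeries.C c :=
  HahnSeries.embDomainRingHom_C

lemma expandLaurent_single (k : ℤ) (c : L) :
    expandLaurent m hm (HahnSeries.single k c) = HahnSeries.single (m * k) c :=
  HahnSeries.embDomain_single

lemma order_expandLaurent (s : LaurentSeries L) :
    (expandLaurent m hm s).order = m * s.order := by
  by_cases hs : s = 0
  · simp [hs]
  have hs' : expandLaurent m hm s ≠ 0 := fun h =>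
    hs (expandLaurent_injective (by rw [h, map_zero]))
  have h := HahnSeries.orderTop_embDomain (x := s)
    (f := ⟨⟨AddMonoidHom.mulLeft (m : ℤ), fun _ _ h => mul_left_cancel₀ (by exact_mod_cast hm.ne') h⟩,
      mul_le_mul_iff_right₀ (by exact_mod_cast hm)⟩)
  rw [← HahnSeries.order_eq_orderTop_of_ne_zero hs, WithTop.map_coe] at h
  change (expandLaurent m hm s).orderTop = _ at h
  rw [← HahnSeries.order_eq_orderTop_of_ne_zero hs', WithTop.coe_inj] at h
  exact h

lemma mem_range_expandLaurent {s : LaurentSeries L} :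
    s ∈ (expandLaurent m hm : LaurentSeries L →+* _).range ↔
      ∀ k : ℤ, ¬ (m : ℤ) ∣ k → s.coeff k = 0 := by
  constructor
  · rintro ⟨u, rfl⟩ k hk
    exact coeff_expandLaurent_of_not_dvd u hk
  · intro h
    -- For `k < 0` one has `s.order ≤ m k ≤ k`; the `0` in the minimum covers `k ≥ 0`.
    refine ⟨HahnSeries.ofSuppBddBelow (fun k : ℤ => s.coeff (m * k)) ⟨min s.order 0, ?_⟩, ?_⟩
    · intro k hk
      have h1 : s.order ≤ m * k := HahnSeries.order_le_of_coeff_ne_zero hk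
      rcases le_or_gt 0 k with h0 | h0
      · exact (min_le_right _ _).trans h0
      · refine (min_le_left _ _).trans (h1.trans ?_)
        have : (1 : ℤ) ≤ m := by exact_mod_cast hm
        nlinarith
    · ext k
      by_cases hk : (m : ℤ) ∣ k
      · obtain ⟨j, rfl⟩ := hk
        rw [coeff_expandLaurent_mul]
        rfl
      · rw [coeff_expandLaurent_of_not_dvd _ hk, h k hk]

lemma eval₂_C_add_single_eq_ofPowerSeries (α : L) {e : ℕ} (he : 0 < e) (p : L[X]) :
    ∃ s : PowerSeries L, PowerSeries.constantCoeff s = p.eval α ∧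
      eval₂ HahnSeries.C (HahnSeries.C α + HahnSeries.single (e : ℤ) (1 : L)) p =
        HahnSeries.ofPowerSeries ℤ L s := by
  refine ⟨eval₂ PowerSeries.C (PowerSeries.C α + PowerSeries.X ^ e) p, ?_, ?_⟩
  · rw [hom_eval₂]
    have : (PowerSeries.constantCoeff (R := L)).comp PowerSeries.C = RingHom.id L :=
      RingHom.ext fun a => by simp
    rw [this]
    simp [he.ne', eval₂_id]
  · rw [hom_eval₂]
    have : (HahnSeries.ofPowerSeries ℤ L).comp PowerSeries.C = HahnSeries.C :=
      RingHom.ext fun a => HahnSeries.ofPowerSeries_C a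
    rw [this, map_add, HahnSeries.ofPowerSeries_C, HahnSeries.ofPowerSeries_X_pow]

lemma coeff_ofPowerSeries_of_neg (s : PowerSeries L) {k : ℤ} (hk : k < 0) :
    (HahnSeries.ofPowerSeries ℤ L s).coeff k = 0 := by
  rw [PowerSeries.coeff_coe, if_pos hk]

lemma coeff_ofPowerSeries_zero (s : PowerSeries L) :
    (HahnSeries.ofPowerSeries ℤ L s).coeff 0 = PowerSeries.constantCoeff s := by
  rw [PowerSeries.coeff_coe, if_neg (lt_irrefl _)]
  simp

end Laurent

/-! ### Restricting Puiseux expansions to the base curve -/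

section Restriction

/-- A ring homomorphism with values in the range of an injective one factors through it. -/
lemma exists_comp_eq_of_injective {A B R : Type*} [Ring A] [Ring B] [Ring R] {i : A →+* B}
    (hi : Function.Injective i) {ρ : R →+* B} (hρ : ∀ r, ρ r ∈ i.range) :
    ∃ σ : R →+* A, ∀ r, i (σ r) = ρ r := by
  let E : A ≃+* i.range := RingEquiv.ofBijective i.rangeRestrict
    ⟨fun u v huv => hi (congrArg Subtype.val huv), i.rangeRestrict_surjective⟩
  exact ⟨(E.symm : i.range →+* A).comp (ρ.codRestrict i.range hρ), fun r =>
    congrArg Subtype.val (E.apply_symm_apply ⟨ρ r, hρ r⟩)⟩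

variable {K F L : Type*} [Field K] [Field F] [Algebra K F] [Field L] [Algebra K L]

lemma map_aeval_eq_eval₂ {ρ : F →+* LaurentSeries L}
    (hρ : ∀ c : K, ρ (algebraMap K F c) = HahnSeries.C (algebraMap K L c)) (x : F) (p : K[X]) :
    ρ (aeval x p) = eval₂ HahnSeries.C (ρ x) (p.map (algebraMap K L)) := by
  rw [aeval_def, hom_eval₂, eval₂_map]
  congr 1
  exact RingHom.ext hρ

/-- A subfield of the field of Laurent series is stable under a derivation over the constants
as soon as it contains the derivative of an element `x` over which it is algebraic. -/
lemma exists_derivation_eq [CharZero K] {x y : F} (hx : Transcendental K x) {f : K[X][X]}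
    (hf : IsDefiningPolynomial x y f) (hxy : IntermediateField.adjoin K {x, y} = ⊤)
    {ρ : F →+* LaurentSeries L}
    (hρ : ∀ c : K, ρ (algebraMap K F c) = HahnSeries.C (algebraMap K L c))
    (D : LaurentSeries L →+ LaurentSeries L) (hleib : ∀ a b, D (a * b) = a * D b + D a * b)
    (hDC : ∀ c : L, D (HahnSeries.C c) = 0) (hD : ∃ h, D (ρ x) = ρ h) (g : F) :
    ∃ h, D (ρ g) = ρ h := by
  have hconst : ∀ c : K, D (ρ (algebraMap K F c)) = 0 := fun c => by
    rw [hρ]; exact hDC _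
  obtain ⟨dx, hdx⟩ := hD
  have hmul : ∀ {a b da db : F}, D (ρ a) = ρ da → D (ρ b) = ρ db →
      D (ρ (a * b)) = ρ (a * db + b * da) := by
    intro a b da db ha hb
    rw [map_mul, hleib, ha, hb, map_add, map_mul, map_mul, mul_comm (ρ da)]
  have hpoly : ∀ p : K[X], ∃ h, D (ρ (aeval x p)) = ρ h := by
    intro p
    induction p using Polynomial.induction_on with
    | C a => exact ⟨0, by rw [aeval_C, hconst, map_zero]⟩
    | add p q hp hq =>
      obtain ⟨a, ha⟩ := hp
      obtain ⟨b, hb⟩ := hq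
      exact ⟨a + b, by rw [map_add, map_add, map_add, ha, hb, map_add]⟩
    | monomial n a ih =>
      obtain ⟨b, hb⟩ := ih
      rw [pow_succ, ← mul_assoc, map_mul (aeval x), aeval_X]
      exact ⟨_, hmul hb hdx⟩
  -- The chain rule, with the part coming from `D x` collected in `h`. For `p = f` it is a linear
  -- equation for `D y`, solvable since `f_Y(x, y) ≠ 0`.
  have hbiv : ∀ p : K[X][X], ∃ h, D (ρ (aevalAeval x y p)) =
      ρ h + ρ (aevalAeval x y (derivative p)) * D (ρ y) := by
    intro p
    induction p using Polynomial.induction_on with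
    | C a =>
      obtain ⟨h, hh⟩ := hpoly a
      exact ⟨h, by rw [aevalAeval_C, hh, derivative_C, map_zero, map_zero, zero_mul, add_zero]⟩
    | add p q hp hq =>
      obtain ⟨a, ha⟩ := hp
      obtain ⟨b, hb⟩ := hq
      refine ⟨a + b, ?_⟩
      rw [map_add, map_add, map_add, ha, hb, derivative_add, map_add, map_add, map_add]
      ring
    | monomial n a ih =>
      obtain ⟨b, hb⟩ := ih
      refine ⟨b * y, ?_⟩
      rw [pow_succ, ← mul_assoc, map_mul (aevalAeval x y) _ X, aevalAeval_Y, map_mul, hleib,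
        hb, derivative_mul (f := C a * X ^ n) (g := X), map_add, derivative_X, mul_one,
        map_mul (aevalAeval x y) _ X, aevalAeval_Y, map_add, map_mul ρ b, map_mul ρ _ y]
      ring
  have hy : ∃ h, D (ρ y) = ρ h := by
    obtain ⟨h, hh⟩ := hbiv f
    rw [hf.2.1, map_zero, map_zero] at hh
    have hpos := hf.natDegree_pos hx
    have hne : aevalAeval x y (derivative f) ≠ 0 := by
      intro h0
      have hdvd := hf.dvd hx h0
      have hd0 : derivative f ≠ 0 := by
        intro h0
        have := derivative_eq_zero.1 h0
        omega
      have := natDegree_le_of_dvd hdvd hd0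
      have := natDegree_derivative_lt hpos.ne'
      omega
    have hne' : ρ (aevalAeval x y (derivative f)) ≠ 0 := (map_ne_zero ρ).2 hne
    refine ⟨-h / aevalAeval x y (derivative f), ?_⟩
    rw [map_div₀, map_neg, eq_div_iff hne', eq_neg_iff_add_eq_zero, hh]
    ring
  have hg : g ∈ IntermediateField.adjoin K {x, y} := by rw [hxy]; trivial
  induction hg using IntermediateField.adjoin_induction with
  | mem z hz =>
    rcases hz with rfl | hz
    · exact ⟨dx, hdx⟩
    · rw [Set.mem_singleton_iff] at hz
      rw [hz]; exact hy
  | algebraMap c => exact ⟨0, by rw [hconst, map_zero]⟩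
  | add a b _ _ ha hb =>
    obtain ⟨a', ha⟩ := ha
    obtain ⟨b', hb⟩ := hb
    exact ⟨a' + b', by rw [map_add, map_add, ha, hb, map_add]⟩
  | inv a _ ha =>
    obtain ⟨a', ha⟩ := ha
    refine ⟨-(a⁻¹ ^ 2 * a'), ?_⟩
    by_cases h0 : a = 0
    · rw [h0, inv_zero, zero_pow two_ne_zero, zero_mul, neg_zero, map_zero, map_zero]
    have h1 : ρ a * ρ a⁻¹ = 1 := by rw [← map_mul, mul_inv_cancel₀ h0, map_one]
    have h2 := hDC 1
    rw [map_one, ← h1, hleib, ha] at h2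
    rw [map_neg, map_mul, map_pow]
    linear_combination ρ a⁻¹ * h2 - D (ρ a⁻¹) * h1
  | mul a b _ _ ha hb =>
    obtain ⟨a', ha⟩ := ha
    obtain ⟨b', hb⟩ := hb
    exact ⟨_, hmul ha hb⟩

/-- If all orders of the elements of the subfield `ρ F` are divisible by `m`, then all its elements
are Laurent series in `t ^ m`. -/
lemma mem_range_expandLaurent_of_dvd_order [CharZero K] [Algebra.IsAlgebraic K L] {x y : F}
    (hx : Transcendental K x) {f : K[X][X]} (hf : IsDefiningPolynomial x y f)
    (hxy : IntermediateField.adjoin K {x, y} = ⊤) {ρ : F →+* LaurentSeries L}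
    (hρ : ∀ c : K, ρ (algebraMap K F c) = HahnSeries.C (algebraMap K L c)) {α : L} {e : ℕ}
    (he : 0 < e) (hρx : ρ x = HahnSeries.C α + HahnSeries.single (e : ℤ) (1 : L)) {m : ℕ}
    (hm : 0 < m) (hme : m ∣ e) (hord : ∀ g, (m : ℤ) ∣ (ρ g).order) (g : F) :
    ρ g ∈ (expandLaurent m hm : LaurentSeries L →+* _).range := by
  have hint : IsIntegral K α := Algebra.IsIntegral.isIntegral α
  have : CharZero L := charZero_of_injective_algebraMap (algebraMap K L).injective
  set R : Subring (LaurentSeries L) := (expandLaurent m hm : LaurentSeries L →+* _).range with hR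
  -- Since `α` need not lie in `K`, `x - α` need not lie in `F`. Its substitute is `M(x) = (x - α)
  -- V(x)`, where `V(α) = M'(α) ≠ 0` by separability.
  set M := minpoly K α with hM
  have hMα : (M.map (algebraMap K L)).IsRoot α := by
    rw [IsRoot, eval_map_algebraMap]; exact minpoly.aeval K α
  obtain ⟨V, hV⟩ := dvd_iff_isRoot.2 hMα
  have hM' : V.eval α = (M.derivative.map (algebraMap K L)).eval α := by
    rw [← derivative_map, hV]; simp [derivative_mul]
  have hc : V.eval α ≠ 0 := by
    rw [hM', eval_map_algebraMap]
    exact (minpoly.irreducible hint).separable.aeval_derivative_ne_zero (minpoly.aeval K α)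
  have hCR : ∀ c : L, (HahnSeries.C c : LaurentSeries L) ∈ R := fun c => ⟨_, expandLaurent_C c⟩
  have hρxR : ρ x ∈ R := by
    rw [hρx]
    refine add_mem (hCR α) ?_
    obtain ⟨d, rfl⟩ := hme
    exact ⟨HahnSeries.single (d : ℤ) (1 : L), by rw [expandLaurent_single, Nat.cast_mul]⟩
  have hevR : ∀ p : L[X], eval₂ HahnSeries.C (ρ x) p ∈ R := fun p => by
    rw [eval₂_eq_sum_range]
    exact sum_mem fun i _ => mul_mem (hCR _) (pow_mem hρxR i)
  set W : LaurentSeries L := eval₂ HahnSeries.C (ρ x) V with hW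
  set U : LaurentSeries L := ρ (aeval x M.derivative) with hU
  have hU' : U = eval₂ HahnSeries.C (ρ x) (M.derivative.map (algebraMap K L)) :=
    map_aeval_eq_eval₂ hρ x _
  have hvan : ∀ p : L[X], (∀ k < 0, (eval₂ HahnSeries.C (ρ x) p).coeff k = 0) ∧
      (eval₂ HahnSeries.C (ρ x) p).coeff 0 = p.eval α := by
    intro p
    obtain ⟨s, hs, hs'⟩ := eval₂_C_add_single_eq_ofPowerSeries α he p
    rw [hρx, hs']
    exact ⟨fun k hk => coeff_ofPowerSeries_of_neg s hk, by rw [coeff_ofPowerSeries_zero, hs]⟩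
  have hWR : W ∈ R := hevR V
  have hUR : U ∈ R := hU' ▸ hevR _
  obtain ⟨hW0, hW1⟩ := hvan V
  obtain ⟨hU0, hU1⟩ := hvan (M.derivative.map (algebraMap K L))
  rw [← hU', ← hM'] at hU1
  rw [← hU'] at hU0
  rw [← hW] at hW0 hW1
  -- The Euler derivation sends `x` to `e (x - α)`; the weight `W = V(x)` turns this into `e M(x)`,
  -- so that `D` preserves `ρ F`.
  let D : LaurentSeries L →+ LaurentSeries L :=
    AddMonoidHom.mk' (fun s => W * eulerSeries s) fun a b => by rw [eulerSeries_add, mul_add]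
  have hDs : ∀ s, D s = W * eulerSeries s := fun s => rfl
  have hleib : ∀ a b, D (a * b) = a * D b + D a * b := fun a b => by
    rw [hDs, hDs, hDs, eulerSeries_mul]
    ring
  have hDC : ∀ c : L, D (HahnSeries.C c) = 0 := fun c => by
    rw [hDs, eulerSeries_C, mul_zero]
  have hDx : D (ρ x) = ρ (e * aeval x M) := by
    rw [map_mul, map_natCast, map_aeval_eq_eval₂ hρ, hV, eval₂_mul, ← hW, hDs]
    have h1 : eulerSeries (ρ x) = (e : LaurentSeries L) * HahnSeries.single (e : ℤ) (1 : L) := by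
      rw [← map_natCast (HahnSeries.C (Γ := ℤ) (R := L)), HahnSeries.C_mul_eq_smul, hρx]
      ext k
      rw [coeff_eulerSeries, HahnSeries.coeff_add, HahnSeries.coeff_smul, HahnSeries.C_apply,
        HahnSeries.coeff_single, HahnSeries.coeff_single]
      split_ifs with h1 h2 h2 <;> simp_all
    rw [h1, eval₂_sub, eval₂_X, eval₂_C, hρx]
    ring
  have hθR : ∀ s ∈ R, eulerSeries s ∈ R := by
    intro s hs
    rw [hR, mem_range_expandLaurent] at hs ⊢
    intro k hk
    rw [coeff_eulerSeries, hs k hk, mul_zero]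
  -- Induction on the gap between the order and the first exponent `κ` outside `mℤ`. Gap zero
  -- contradicts `m ∣ order`.
  have main : ∀ (n : ℕ) (g : F) (κ : ℤ), ¬ (m : ℤ) ∣ κ → (ρ g).coeff κ ≠ 0 →
      (∀ k < κ, ¬ (m : ℤ) ∣ k → (ρ g).coeff k = 0) → κ - (ρ g).order ≤ n → False := by
    intro n
    induction n with
    | zero =>
      intro g κ hκ hne _ hn
      have h1 : (ρ g).order ≤ κ := HahnSeries.order_le_of_coeff_ne_zero hne
      have h2 : (ρ g).order = κ := by push_cast at hn; omega
      exact hκ (h2 ▸ hord g)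
    | succ n ih =>
      intro g κ hκ hne hlt hn
      set s := ρ g with hs
      set k := s.order with hk
      have hs_van : ∀ j < k, s.coeff j = 0 := fun j hj => HahnSeries.coeff_eq_zero_of_lt_order hj
      have hkκ : k < κ := lt_of_le_of_ne (HahnSeries.order_le_of_coeff_ne_zero hne)
        fun h => hκ (h ▸ hord g)
      obtain ⟨h, hh⟩ := exists_derivation_eq hx hf hxy hρ D hleib hDC ⟨_, hDx⟩ g
      -- `T` preserves `ρ F`, as `U = M'(x)`. Because `W` and `U` have the same constant term
      -- `V(α)`, `T` multiplies a leading coefficient at `j` by `V(α) (j - k)`: it kills the leading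
      -- term of `s`, of order `k`, but not the term at `κ`.
      let T : LaurentSeries L → LaurentSeries L := fun u =>
        W * eulerSeries u - U * (HahnSeries.C (k : L) * u)
      have hT : ρ (h - aeval x M.derivative * ((k : F) * g)) = T s := by
        rw [map_sub, ← hh, map_mul, map_mul, map_intCast, hDs,
          ← map_intCast (HahnSeries.C (Γ := ℤ) (R := L))]
      have hTvan : ∀ (u : LaurentSeries L) (j : ℤ), (∀ i < j, u.coeff i = 0) →
          (∀ i < j, (T u).coeff i = 0) ∧
            (T u).coeff j = V.eval α * ((j - k : ℤ) : L) * u.coeff j := by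
        intro u j hu
        have h1 := coeff_mul_of_vanish (b := eulerSeries u) hW0 (j := j)
          (fun i hi => by rw [coeff_eulerSeries, hu i hi, mul_zero])
        have h2 := coeff_mul_of_vanish (b := HahnSeries.C (k : L) * u) hU0 (j := j)
          (fun i hi => by rw [HahnSeries.C_mul_eq_smul, HahnSeries.coeff_smul, hu i hi, smul_zero])
        rw [zero_add, hW1, coeff_eulerSeries] at h1
        rw [zero_add, hU1, HahnSeries.C_mul_eq_smul, HahnSeries.coeff_smul, smul_eq_mul] at h2
        constructor
        · intro i hi
          change (W * _ - U * _).coeff i = 0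
          rw [HahnSeries.coeff_sub, h1.1 i hi, HahnSeries.C_mul_eq_smul, h2.1 i hi, sub_zero]
        · change (W * _ - U * _).coeff j = _
          rw [HahnSeries.coeff_sub, h1.2, HahnSeries.C_mul_eq_smul, h2.2]
          push_cast
          ring
      -- The part of `s` in `t^m`. As `W` and `U` are series in `t^m`, `T s₀` contributes nothing
      -- outside `mℤ`, and `s - s₀` starts at `κ`.
      let s₀ : LaurentSeries L :=
        { coeff := fun j => if (m : ℤ) ∣ j then s.coeff j else 0
          isPWO_support' := s.isPWO_support.mono fun j hj h0 => hj (by simp [h0]) }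
      have hs₀ : ∀ j, s₀.coeff j = if (m : ℤ) ∣ j then s.coeff j else 0 := fun j => rfl
      have hs₀R : T s₀ ∈ R := by
        have : s₀ ∈ R := by
          rw [hR, mem_range_expandLaurent]
          intro j hj
          rw [hs₀, if_neg hj]
        exact sub_mem (mul_mem hWR (hθR _ this)) (mul_mem hUR (mul_mem (hCR _) this))
      rw [hR, mem_range_expandLaurent] at hs₀R
      have hTs : T s = T s₀ + T (s - s₀) := by
        have h0 := eulerSeries_add s₀ (s - s₀)
        rw [add_sub_cancel] at h0
        simp only [T, h0]
        ring
      obtain ⟨h1, h2⟩ := hTvan (s - s₀) κ (by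
        intro j hj
        rw [HahnSeries.coeff_sub, hs₀]
        split_ifs with hd
        · rw [sub_self]
        · rw [hlt j hj hd, sub_zero])
      have hTκ : (T s).coeff κ ≠ 0 := by
        rw [hTs, HahnSeries.coeff_add, hs₀R κ hκ, zero_add, h2, HahnSeries.coeff_sub, hs₀,
          if_neg hκ, sub_zero]
        exact mul_ne_zero (mul_ne_zero hc (Int.cast_ne_zero.2 (by omega))) hne
      have hTne : T s ≠ 0 := fun h0 => hTκ (by rw [h0, HahnSeries.coeff_zero])
      refine ih (h - aeval x M.derivative * ((k : F) * g)) κ hκ (by rwa [hT]) ?_ ?_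
      · intro j hj hd
        rw [hT, hTs, HahnSeries.coeff_add, hs₀R j hd, h1 j hj, add_zero]
      · rw [hT]
        have hord' : k + 1 ≤ (T s).order := by
          rw [HahnSeries.le_order_iff_forall hTne]
          intro j hj
          obtain ⟨h3, h4⟩ := hTvan s k hs_van
          rcases lt_or_eq_of_le (Int.lt_add_one_iff.1 hj) with hlt' | rfl
          · exact h3 j hlt'
          · rw [h4, sub_self, Int.cast_zero, mul_zero, zero_mul]
        push_cast at hn
        omega
  rw [hR, mem_range_expandLaurent]
  by_contra! hcon
  obtain ⟨κ, hκ, hmin⟩ := Int.exists_least_of_bdd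
    (P := fun k : ℤ => ¬ (m : ℤ) ∣ k ∧ (ρ g).coeff k ≠ 0)
    ⟨(ρ g).order, fun k hk => HahnSeries.order_le_of_coeff_ne_zero hk.2⟩ hcon
  refine main (κ - (ρ g).order).toNat g κ hκ.1 hκ.2 (fun k hk hd => ?_) (Int.self_le_toNat _)
  by_contra h0
  exact absurd (hmin k ⟨hd, h0⟩) (not_le.2 hk)

/-- The expansions of the functions in `F` in a local parameter of a covering curve become, after
the substitution `t ^ m ↦ t` for a suitable `m`, expansions in a local parameter. -/
lemma exists_expandLaurent_comp_eq [CharZero K] [Algebra.IsAlgebraic K L] {x y : F}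
    (hx : Transcendental K x) {f : K[X][X]} (hf : IsDefiningPolynomial x y f)
    (hxy : IntermediateField.adjoin K {x, y} = ⊤) {ρ : F →+* LaurentSeries L}
    (hρ : ∀ c : K, ρ (algebraMap K F c) = HahnSeries.C (algebraMap K L c)) {α : L} {e : ℕ}
    (he : 0 < e) (hρx : ρ x = HahnSeries.C α + HahnSeries.single (e : ℤ) (1 : L)) :
    ∃ (m : ℕ) (hm : 0 < m) (d : ℕ) (σ : F →+* LaurentSeries L), e = m * d ∧
      (∀ g, expandLaurent m hm (σ g) = ρ g) ∧ ∃ g, (σ g).order = 1 := by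
  -- The value group of `F`; `m` is its positive generator.
  let H : AddSubgroup ℤ :=
    { carrier := {k | ∃ g, g ≠ 0 ∧ (ρ g).order = k}
      zero_mem' := ⟨1, one_ne_zero, by simp⟩
      add_mem' := by
        rintro _ _ ⟨a, ha, rfl⟩ ⟨b, hb, rfl⟩
        refine ⟨a * b, mul_ne_zero ha hb, ?_⟩
        rw [map_mul, HahnSeries.order_mul ((map_ne_zero ρ).2 ha) ((map_ne_zero ρ).2 hb)]
      neg_mem' := by
        rintro _ ⟨a, ha, rfl⟩
        refine ⟨a⁻¹, inv_ne_zero ha, ?_⟩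
        have h1 : (ρ (a * a⁻¹)).order = 0 := by
          rw [mul_inv_cancel₀ ha, map_one, HahnSeries.order_one]
        rw [map_mul, HahnSeries.order_mul ((map_ne_zero ρ).2 ha)
          ((map_ne_zero ρ).2 (inv_ne_zero ha))] at h1
        omega }
  obtain ⟨a, ha⟩ := Int.subgroup_cyclic H
  have hmem : ∀ k, k ∈ H ↔ ((a.natAbs : ℕ) : ℤ) ∣ k := by
    intro k
    rw [ha, ← AddSubgroup.zmultiples_eq_closure, Int.mem_zmultiples_iff, Int.natAbs_dvd]
  -- `M(x) = t^e V(x)` has order exactly `e`, whence `m > 0` and `m ∣ e`.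
  have heH : (e : ℤ) ∈ H := by
    set M := minpoly K α
    have hint : IsIntegral K α := Algebra.IsIntegral.isIntegral α
    have hMα : (M.map (algebraMap K L)).IsRoot α := by
      rw [IsRoot, eval_map_algebraMap]; exact minpoly.aeval K α
    obtain ⟨V, hV⟩ := dvd_iff_isRoot.2 hMα
    have hc : V.eval α ≠ 0 := by
      have hM' : V.eval α = (M.derivative.map (algebraMap K L)).eval α := by
        rw [← derivative_map, hV]; simp [derivative_mul]
      rw [hM', eval_map_algebraMap]
      exact (minpoly.irreducible hint).separable.aeval_derivative_ne_zero (minpoly.aeval K α)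
    obtain ⟨s, hs, hs'⟩ := eval₂_C_add_single_eq_ofPowerSeries α he V
    refine ⟨aeval x M, aeval_ne_zero_of_transcendental hx (minpoly.ne_zero hint), ?_⟩
    have h0 : (HahnSeries.ofPowerSeries ℤ L s).coeff 0 ≠ 0 := by
      rwa [coeff_ofPowerSeries_zero, hs]
    have hne : HahnSeries.ofPowerSeries ℤ L s ≠ 0 := HahnSeries.ne_zero_of_coeff_ne_zero h0
    have h1 : (HahnSeries.ofPowerSeries ℤ L s).order = 0 :=
      le_antisymm (HahnSeries.order_le_of_coeff_ne_zero h0)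
        ((HahnSeries.le_order_iff_forall hne).2 fun k hk => coeff_ofPowerSeries_of_neg s hk)
    rw [map_aeval_eq_eval₂ hρ, hV, eval₂_mul, eval₂_sub, eval₂_X, eval₂_C, hρx, hs',
      add_sub_cancel_left, HahnSeries.order_mul (by simp) hne, h1,
      HahnSeries.order_single one_ne_zero, add_zero]
  have hdvd := (hmem e).1 heH
  have hm : 0 < a.natAbs := by
    rcases Nat.eq_zero_or_pos a.natAbs with h | h
    · rw [h] at hdvd
      simp at hdvd
      omega
    · exact h
  have hme : a.natAbs ∣ e := by exact_mod_cast hdvd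
  have hrange : ∀ g, ρ g ∈ (expandLaurent a.natAbs hm : LaurentSeries L →+* _).range := by
    refine mem_range_expandLaurent_of_dvd_order hx hf hxy hρ he hρx hm hme fun g => ?_
    by_cases hg : g = 0
    · rw [hg, map_zero, HahnSeries.order_zero]; exact dvd_zero _
    · exact (hmem _).1 ⟨g, hg, rfl⟩
  obtain ⟨d, hd⟩ := hme
  obtain ⟨σ, hσ⟩ := exists_comp_eq_of_injective expandLaurent_injective hrange
  refine ⟨a.natAbs, hm, d, σ, hd, hσ, ?_⟩
  obtain ⟨g, -, hg⟩ := (hmem (a.natAbs : ℤ)).2 dvd_rfl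
  refine ⟨g, ?_⟩
  have h1 := order_expandLaurent (hm := hm) (σ g)
  rw [hσ, hg] at h1
  have hm' : (a.natAbs : ℤ) ≠ 0 := by exact_mod_cast hm.ne'
  exact (mul_left_cancel₀ hm' (by rw [mul_one]; exact h1)).symm

end Restriction

/-! ### Bounded series and their values without completeness -/

section BoundedSeries

variable {L : Type*} [Field L] {w : AbsoluteValue L ℝ}

lemma apply_sum_le_of_isNonarchimedean {ι : Type*} (hw : IsNonarchimedean w) (s : Finset ι) (g : ι → L)
    {C : ℝ} (hC : 0 ≤ C) (h : ∀ i ∈ s, w (g i) ≤ C) : w (∑ i ∈ s, g i) ≤ C := by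
  classical
  induction s using Finset.induction_on with
  | empty => simpa using hC
  | insert a s ha ih =>
    rw [Finset.sum_insert ha]
    refine (hw _ _).trans (max_le (h a (Finset.mem_insert_self _ _)) (ih fun i hi => h i ?_))
    exact Finset.mem_insert_of_mem hi

/-- The ring of integers of a non-archimedean absolute value. -/
def integerSubring (hw : IsNonarchimedean w) : Subring L where
  carrier := {z | w z ≤ 1}
  zero_mem' := by simp
  one_mem' := by simp
  add_mem' := fun {a b} ha hb => (hw a b).trans (max_le ha hb)
  neg_mem' := fun {a} ha => by simpa using ha
  mul_mem' := fun {a b} ha hb => by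
    change w (a * b) ≤ 1
    rw [w.map_mul]
    exact mul_le_one₀ ha (w.nonneg _) hb

/-- The Laurent series with bounded coefficients. -/
def boundedSeries (hw : IsNonarchimedean w) : Subring (LaurentSeries L) where
  carrier := {s | ∃ C : ℝ, ∀ k, w (s.coeff k) ≤ C}
  zero_mem' := ⟨0, fun k => by simp⟩
  one_mem' := ⟨1, fun k => by
    rw [HahnSeries.coeff_one]; split_ifs <;> simp⟩
  add_mem' := by
    rintro a b ⟨C, hC⟩ ⟨D, hD⟩
    refine ⟨max C D, fun k => ?_⟩
    rw [HahnSeries.coeff_add]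
    exact (hw _ _).trans (max_le_max (hC k) (hD k))
  neg_mem' := by
    rintro a ⟨C, hC⟩
    exact ⟨C, fun k => by rw [HahnSeries.coeff_neg, w.map_neg]; exact hC k⟩
  mul_mem' := by
    rintro a b ⟨C, hC⟩ ⟨D, hD⟩
    have hC0 : 0 ≤ C := (w.nonneg _).trans (hC 0)
    have hD0 : 0 ≤ D := (w.nonneg _).trans (hD 0)
    refine ⟨C * D, fun k => ?_⟩
    rw [HahnSeries.coeff_mul]
    refine apply_sum_le_of_isNonarchimedean hw _ _ (mul_nonneg hC0 hD0) fun ij _ => ?_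
    rw [w.map_mul]
    exact mul_le_mul (hC _) (hD _) (w.nonneg _) hC0

lemma mem_boundedSeries {hw : IsNonarchimedean w} {s : LaurentSeries L} :
    s ∈ boundedSeries hw ↔ ∃ C : ℝ, ∀ k, w (s.coeff k) ≤ C := Iff.rfl

lemma single_mem_boundedSeries (hw : IsNonarchimedean w) (n : ℤ) (a : L) :
    HahnSeries.single n a ∈ boundedSeries hw :=
  ⟨w a, fun k => by rw [HahnSeries.coeff_single]; split_ifs <;> simp⟩

lemma C_mem_boundedSeries (hw : IsNonarchimedean w) (a : L) :
    (HahnSeries.C a : LaurentSeries L) ∈ boundedSeries hw :=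
  single_mem_boundedSeries hw 0 a

/-- `s` has bounded coefficients and takes the value `c` at `τ`, in the sense that `s - c` is
divisible by `t - τ`. -/
def HasBoundedValue (hw : IsNonarchimedean w) (τ : L) (s : LaurentSeries L) (c : L) : Prop :=
  s ∈ boundedSeries hw ∧ ∃ h ∈ boundedSeries hw,
    s - HahnSeries.C c = (HahnSeries.single 1 1 - HahnSeries.C τ) * h

namespace HasBoundedValue

variable {hw : IsNonarchimedean w} {τ : L} {s s' : LaurentSeries L} {c c' : L}

lemma const (hw : IsNonarchimedean w) (τ a : L) : HasBoundedValue hw τ (HahnSeries.C a) a :=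
  ⟨C_mem_boundedSeries hw a, 0, zero_mem _, by rw [sub_self, mul_zero]⟩

lemma variable_self (hw : IsNonarchimedean w) (τ : L) :
    HasBoundedValue hw τ (HahnSeries.single 1 1) τ :=
  ⟨single_mem_boundedSeries hw 1 1, 1, one_mem _, by rw [mul_one]⟩

lemma add (h : HasBoundedValue hw τ s c) (h' : HasBoundedValue hw τ s' c') :
    HasBoundedValue hw τ (s + s') (c + c') := by
  obtain ⟨hs, u, hu, e⟩ := h
  obtain ⟨hs', u', hu', e'⟩ := h'
  refine ⟨add_mem hs hs', u + u', add_mem hu hu', ?_⟩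
  rw [mul_add, ← e, ← e', map_add]
  ring

lemma mul (h : HasBoundedValue hw τ s c) (h' : HasBoundedValue hw τ s' c') :
    HasBoundedValue hw τ (s * s') (c * c') := by
  obtain ⟨hs, u, hu, e⟩ := h
  obtain ⟨hs', u', hu', e'⟩ := h'
  refine ⟨mul_mem hs hs', u * s' + HahnSeries.C c * u',
    add_mem (mul_mem hu hs') (mul_mem (C_mem_boundedSeries hw c) hu'), ?_⟩
  rw [mul_add, ← mul_assoc, ← e, mul_left_comm, ← e', map_mul]
  ring

lemma pow (h : HasBoundedValue hw τ s c) (n : ℕ) : HasBoundedValue hw τ (s ^ n) (c ^ n) := by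
  induction n with
  | zero => simpa using const hw τ (1 : L)
  | succ n ih => rw [pow_succ, pow_succ]; exact ih.mul h

/-- Boundedness of `s⁻¹` has to be assumed: the reciprocal of `t - γ` with `0 < |γ| < 1` is
unbounded. -/
lemma inv (h : HasBoundedValue hw τ s c) (hs' : s⁻¹ ∈ boundedSeries hw) (hs0 : s ≠ 0)
    (hc : c ≠ 0) : HasBoundedValue hw τ s⁻¹ c⁻¹ := by
  obtain ⟨hs, u, hu, e⟩ := h
  refine ⟨hs', -(s⁻¹ * HahnSeries.C c⁻¹ * u), neg_mem (mul_mem (mul_mem hs'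
    (C_mem_boundedSeries hw _)) hu), ?_⟩
  have hC : (HahnSeries.C c : LaurentSeries L) * HahnSeries.C c⁻¹ = 1 := by
    rw [← map_mul, mul_inv_cancel₀ hc, map_one]
  calc s⁻¹ - HahnSeries.C c⁻¹
      = s⁻¹ * (HahnSeries.C c * HahnSeries.C c⁻¹) - (s⁻¹ * s) * HahnSeries.C c⁻¹ := by
        rw [hC, inv_mul_cancel₀ hs0, mul_one, one_mul]
    _ = -(s⁻¹ * HahnSeries.C c⁻¹) * (s - HahnSeries.C c) := by ring
    _ = _ := by rw [e]; ring

end HasBoundedValue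

lemma coeff_single_sub_C_mul (h : LaurentSeries L) (τ : L) (k : ℤ) :
    ((HahnSeries.single 1 1 - HahnSeries.C τ) * h).coeff k = h.coeff (k - 1) - τ * h.coeff k := by
  rw [sub_mul, HahnSeries.coeff_sub, HahnSeries.C_mul_eq_smul, HahnSeries.coeff_smul, smul_eq_mul]
  have := HahnSeries.coeff_single_mul_add (r := (1 : L)) (x := h) (a := k - 1) (b := 1)
  rw [sub_add_cancel, one_mul] at this
  rw [this]

lemma sum_Ico_int_succ {M : Type*} [AddCommMonoid M] (f : ℤ → M) {a b : ℤ} (hab : a ≤ b) :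
    ∑ k ∈ Finset.Ico a (b + 1), f k = ∑ k ∈ Finset.Ico a b, f k + f b := by
  have : Finset.Ico a (b + 1) = insert b (Finset.Ico a b) := by
    ext k; simp only [Finset.mem_Ico, Finset.mem_insert]; omega
  rw [this, Finset.sum_insert (by simp), add_comm]

/-- Partial sums may be started at any index below the order. -/
lemma sum_Ico_eq_partialSum {s : LaurentSeries L} {n : ℤ} (hn : n ≤ s.order) (τ : L) (N : ℕ) :
    ∑ k ∈ Finset.Ico n (N : ℤ), s.coeff k * τ ^ k = partialSum s τ N := by
  refine (Finset.sum_subset (Finset.Ico_subset_Ico_left hn) fun k hk hk' => ?_).symm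
  rw [HahnSeries.coeff_eq_zero_of_lt_order, zero_mul]
  simp only [Finset.mem_Ico] at hk hk'
  omega

/-- The terms of `(t - τ) h` at `τ` are `h_{k-1} τ^k - h_k τ^(k+1)`, and they telescope. With `N >
0` the range of summation contains the exponent `0` of the constant `c`. -/
lemma partialSum_eq_of_bounded_quotient {s h : LaurentSeries L} {τ c : L} (hτ : τ ≠ 0)
    (e : s - HahnSeries.C c = (HahnSeries.single 1 1 - HahnSeries.C τ) * h) {N : ℕ} (hN : 0 < N) :
    partialSum s τ N - c = - (h.coeff (N - 1) * τ ^ N) := by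
  set n : ℤ := min s.order (min h.order 0) with hn
  have h1 : ∀ m : ℤ, n ≤ m →
      ∑ k ∈ Finset.Ico n m, (s - HahnSeries.C c).coeff k * τ ^ k = - (h.coeff (m - 1) * τ ^ m) := by
    intro m hm
    induction m, hm using Int.leInduction with
    | base =>
      rw [Finset.Ico_self, Finset.sum_empty, HahnSeries.coeff_eq_zero_of_lt_order (by omega)]
      simp
    | succ m hm ih =>
      rw [sum_Ico_int_succ _ hm, ih, e, coeff_single_sub_C_mul, zpow_add_one₀ hτ,
        add_sub_cancel_right]
      ring
  have h2 := h1 N (by omega)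
  rw [zpow_natCast] at h2
  rw [← h2, ← sum_Ico_eq_partialSum (n := n) (by omega)]
  simp only [HahnSeries.coeff_sub, sub_mul, Finset.sum_sub_distrib]
  congr 1
  rw [Finset.sum_eq_single 0]
  · simp
  · intro k _ hk
    rw [HahnSeries.C_apply, HahnSeries.coeff_single_of_ne hk, zero_mul]
  · intro h0
    exact absurd (Finset.mem_Ico.2 ⟨by omega, by omega⟩) h0

lemma HasBoundedValue.sumsTo {hw : IsNonarchimedean w} {τ : L} {s : LaurentSeries L} {c : L}
    (h : HasBoundedValue hw τ s c) (hτ : τ ≠ 0) (hτ1 : w τ < 1) : SumsTo w s τ c := by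
  obtain ⟨hs, u, ⟨C, hC⟩, e⟩ := h
  refine ⟨fun h0 => absurd h0 hτ, ?_⟩
  have h1 : Filter.Tendsto (fun N : ℕ => C * w τ ^ N) Filter.atTop (nhds 0) := by
    simpa using (tendsto_pow_atTop_nhds_zero_of_lt_one (w.nonneg τ) hτ1).const_mul C
  refine squeeze_zero' (Filter.Eventually.of_forall fun N => w.nonneg _) ?_ h1
  filter_upwards [Filter.eventually_gt_atTop 0] with N hN
  rw [partialSum_eq_of_bounded_quotient hτ e hN, w.map_neg, w.map_mul, w.map_pow]
  exact mul_le_mul_of_nonneg_right (hC _) (pow_nonneg (w.nonneg _) _)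

/-- Formal division of `s - c` by `t - τ` yields the coefficients `-τ^(-k-1) S(k+1)`, where `S(m)`
is the partial sum of `s - c` over exponents below `m`. As the total sum is zero, `S(m)` is as small
as its tail, which the ultrametric inequality bounds by `C |τ|^m`; so the quotient is bounded. -/
lemma SumsTo.hasBoundedValue (hw : IsNonarchimedean w) {τ : L} {s : LaurentSeries L} {c : L}
    (h : SumsTo w s τ c) (hs : s ∈ boundedSeries hw) (hτ : τ ≠ 0) (hτ1 : w τ < 1) :
    HasBoundedValue hw τ s c := by
  refine ⟨hs, ?_⟩
  set u : LaurentSeries L := s - HahnSeries.C c with hu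
  obtain ⟨C, hC⟩ := sub_mem hs (C_mem_boundedSeries hw c)
  rw [← hu] at hC
  have hC0 : 0 ≤ C := (w.nonneg _).trans (hC 0)
  set n : ℤ := min s.order 0 with hn
  have hun : ∀ k < n, u.coeff k = 0 := by
    intro k hk
    rw [hu, HahnSeries.coeff_sub, HahnSeries.coeff_eq_zero_of_lt_order (by omega),
      HahnSeries.C_apply, HahnSeries.coeff_single_of_ne (by omega), sub_zero]
  let S : ℤ → L := fun m => ∑ k ∈ Finset.Ico n m, u.coeff k * τ ^ k
  have hS : ∀ m < n, S (m + 1) = 0 := fun m hm => by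
    simp only [S]
    rw [Finset.Ico_eq_empty (by omega), Finset.sum_empty]
  have hsucc : ∀ m, S (m + 1) = S m + u.coeff m * τ ^ m := by
    intro m
    rcases le_or_gt n m with h1 | h1
    · exact sum_Ico_int_succ _ h1
    · rw [hS m h1, hun m h1, zero_mul, add_zero]
      simp only [S]
      rw [Finset.Ico_eq_empty (by omega), Finset.sum_empty]
  have hlim : Filter.Tendsto (fun N : ℕ => w (S N)) Filter.atTop (nhds 0) := by
    refine h.2.congr' ?_
    filter_upwards [Filter.eventually_gt_atTop 0] with N hN
    congr 1
    rw [← sum_Ico_eq_partialSum (n := n) (by omega)]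
    simp only [S, hu, HahnSeries.coeff_sub, sub_mul, Finset.sum_sub_distrib]
    congr 1
    rw [Finset.sum_eq_single 0]
    · simp
    · intro k _ hk
      rw [HahnSeries.C_apply, HahnSeries.coeff_single_of_ne hk, zero_mul]
    · intro h0
      exact absurd (Finset.mem_Ico.2 ⟨by omega, by omega⟩) h0
  have hτ0 : 0 < w τ := w.pos hτ
  have htail : ∀ (m : ℤ) (j : ℕ), w (S (m + j) - S m) ≤ C * w τ ^ m := by
    intro m j
    induction j with
    | zero => simpa using mul_nonneg hC0 (zpow_nonneg hτ0.le m)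
    | succ j ih =>
      have e : S (m + (j + 1 : ℕ)) - S m = (S (m + j) - S m) + u.coeff (m + j) * τ ^ (m + j) := by
        push_cast
        rw [← add_assoc, hsucc]
        ring
      rw [e]
      refine (hw _ _).trans (max_le ih ?_)
      rw [w.map_mul, map_zpow₀]
      refine mul_le_mul (hC _) ?_ (zpow_nonneg hτ0.le _) hC0
      exact zpow_le_zpow_right_of_le_one₀ hτ0 hτ1.le (by omega)
  have hbd : ∀ m : ℤ, w (S m) ≤ C * w τ ^ m := by
    intro m
    refine le_of_forall_pos_le_add fun ε hε => ?_
    obtain ⟨N, hN, hN'⟩ := ((hlim.eventually (gt_mem_nhds hε)).and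
      (Filter.eventually_ge_atTop m.toNat)).exists
    have e : S m = S N - (S N - S m) := by ring
    have h2 := htail m (N - m).toNat
    rw [show m + ((N - m).toNat : ℤ) = N by omega] at h2
    calc w (S m) = w (S N - (S N - S m)) := by rw [← e]
      _ ≤ w (S N) + w (S N - S m) := by
        rw [sub_eq_add_neg (S N) (S N - S m)]
        exact (w.add_le _ _).trans (by rw [w.map_neg])
      _ ≤ C * w τ ^ m + ε := by linarith
  let hser : LaurentSeries L := HahnSeries.ofSuppBddBelow
    (fun k : ℤ => -(τ ^ (-(k + 1)) * S (k + 1))) ⟨n, by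
      intro k hk
      by_contra hlt
      exact hk (by simp only; rw [hS k (by omega), mul_zero, neg_zero])⟩
  have hser_coeff : ∀ k, hser.coeff k = -(τ ^ (-(k + 1)) * S (k + 1)) := fun k => rfl
  refine ⟨hser, ⟨C, fun k => ?_⟩, ?_⟩
  · rw [hser_coeff, w.map_neg, w.map_mul, map_zpow₀]
    calc w τ ^ (-(k + 1)) * w (S (k + 1)) ≤ w τ ^ (-(k + 1)) * (C * w τ ^ (k + 1)) :=
          mul_le_mul_of_nonneg_left (hbd _) (zpow_nonneg hτ0.le _)
      _ = C := by rw [zpow_neg]; field_simp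
  · ext k
    rw [coeff_single_sub_C_mul, hser_coeff, hser_coeff, sub_add_cancel, hsucc, zpow_neg, zpow_neg,
      zpow_add_one₀ hτ]
    field_simp
    ring

/-- The reciprocal of `t ^ e + γ` has bounded coefficients when `|γ| ≥ 1`. -/
lemma inv_single_add_C_mem_boundedSeries (hw : IsNonarchimedean w) {e : ℕ} (he : 0 < e) {γ : L}
    (hγ : 1 ≤ w γ) :
    (HahnSeries.single (e : ℤ) (1 : L) + HahnSeries.C γ)⁻¹ ∈ boundedSeries hw := by
  have hγ0 : γ ≠ 0 := fun h => by rw [h, w.map_zero] at hγ; linarith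
  let O := integerSubring hw
  have hg : γ⁻¹ ∈ O := by
    change w γ⁻¹ ≤ 1
    rw [map_inv₀]; exact inv_le_one_of_one_le₀ hγ
  -- After division by `γ` the series is integral with constant term one, hence a unit among
  -- integral power series.
  let s : PowerSeries O := 1 + PowerSeries.C ⟨γ⁻¹, hg⟩ * PowerSeries.X ^ e
  have hs : IsUnit s := by
    rw [PowerSeries.isUnit_iff_constantCoeff]
    simp [s, he.ne']
  obtain ⟨u, hu⟩ := hs.exists_right_inv
  let ψ : PowerSeries O →+* LaurentSeries L :=
    (HahnSeries.ofPowerSeries ℤ L).comp (PowerSeries.map O.subtype)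
  have hψs : HahnSeries.C γ * ψ s = HahnSeries.single (e : ℤ) (1 : L) + HahnSeries.C γ := by
    have h1 : ψ s = 1 + HahnSeries.C γ⁻¹ * HahnSeries.single (e : ℤ) (1 : L) := by
      simp [ψ, s, HahnSeries.ofPowerSeries_C, HahnSeries.ofPowerSeries_X_pow]
    rw [h1, mul_add, ← mul_assoc, ← map_mul, mul_inv_cancel₀ hγ0, map_one, one_mul, mul_one,
      add_comm]
  have hinv : (HahnSeries.single (e : ℤ) (1 : L) + HahnSeries.C γ)⁻¹ =
      HahnSeries.C γ⁻¹ * ψ u := by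
    refine inv_eq_of_mul_eq_one_right ?_
    rw [← hψs]
    calc _ = (HahnSeries.C γ * HahnSeries.C γ⁻¹) * ψ (s * u) := by rw [map_mul ψ]; ring
      _ = 1 := by rw [hu, map_one, ← map_mul, mul_inv_cancel₀ hγ0, map_one, mul_one]
  rw [hinv]
  refine mul_mem (C_mem_boundedSeries hw _) ⟨1, fun k => ?_⟩
  change w ((HahnSeries.ofPowerSeries ℤ L (PowerSeries.map O.subtype u)).coeff k) ≤ 1
  rw [PowerSeries.coeff_coe]
  split_ifs
  · simp
  · rw [PowerSeries.coeff_map]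
    exact (PowerSeries.coeff k.natAbs u).2

/-- The expansion of `p(α + t ^ e)` has a reciprocal with bounded coefficients when the roots of
`p` other than `α` have distance at least one to `α`. -/
lemma inv_eval₂_mem_boundedSeries [IsAlgClosed L] (hw : IsNonarchimedean w) {e : ℕ} (he : 0 < e)
    {α : L} {p : L[X]} (hp : ∀ β, p.IsRoot β → β ≠ α → 1 ≤ w (α - β)) :
    (eval₂ HahnSeries.C (HahnSeries.C α + HahnSeries.single (e : ℤ) (1 : L)) p)⁻¹ ∈
      boundedSeries hw := by
  by_cases hp0 : p = 0
  · rw [hp0, eval₂_zero, inv_zero]; exact zero_mem _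
  -- In the product over the roots, `α` contributes `t^e`, a monomial, and `β ≠ α` contributes `t^e
  -- + (α - β)`.
  rw [(IsAlgClosed.splits p).eq_prod_roots, eval₂_mul, eval₂_C, mul_inv, ← map_inv₀]
  refine mul_mem (C_mem_boundedSeries hw _) ?_
  have hroots : ∀ β ∈ p.roots, β ≠ α → 1 ≤ w (α - β) := fun β hβ => hp β (isRoot_of_mem_roots hβ)
  generalize p.roots = S at hroots
  induction S using Multiset.induction_on with
  | empty => simp
  | cons β S ih =>
    rw [Multiset.map_cons, Multiset.prod_cons, eval₂_mul, mul_inv]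
    refine mul_mem ?_ (ih fun b hb => hroots b (Multiset.mem_cons_of_mem hb))
    rw [eval₂_sub, eval₂_X, eval₂_C]
    by_cases hβ : β = α
    · rw [hβ, add_sub_cancel_left, HahnSeries.inv_single]
      exact single_mem_boundedSeries hw _ _
    · have := inv_single_add_C_mem_boundedSeries hw he (hroots β (Multiset.mem_cons_self _ _) hβ)
      rwa [map_sub, ← add_sub_assoc, add_comm] at this

end BoundedSeries

/-! ### Separation of critical values outside the exceptional places -/

section Separation

lemma range_integerSubring_subtype {L : Type*} [Field L] {w : AbsoluteValue L ℝ}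
    {hw : IsNonarchimedean w} : Set.range (integerSubring hw).subtype = {z | w z ≤ 1} :=
  Subtype.range_coe

lemma mem_lifts_integerSubring {L : Type*} [Field L] {w : AbsoluteValue L ℝ}
    {hw : IsNonarchimedean w} {p : L[X]} :
    p ∈ lifts (integerSubring hw).subtype ↔ ∀ n, w (p.coeff n) ≤ 1 := by
  rw [lifts_iff_coeff_lifts, range_integerSubring_subtype]
  rfl

/-- An extension of a non-archimedean absolute value is non-archimedean. -/
lemma Extends.isNonarchimedean {K L : Type*} [Field K] [Field L] [Algebra K L]
    {w : AbsoluteValue L ℝ} {v : AbsoluteValue K ℝ} (h : Extends w v) (hv : IsNonarchimedean v) :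
    IsNonarchimedean w := by
  let _ : NormedField L := w.toNormedField
  have hnorm : ∀ a : L, ‖a‖ = w a := fun _ => rfl
  have : IsUltrametricDist L := by
    -- Being non-archimedean is detected on the natural numbers, which already lie in `K`.
    refine IsUltrametricDist.isUltrametricDist_of_forall_norm_natCast_le_one fun n => ?_
    rw [hnorm, ← map_natCast (algebraMap K L), h]
    exact hv.apply_natCast_le_one
  intro a b
  rw [← hnorm, ← hnorm, ← hnorm]
  exact IsUltrametricDist.norm_add_le_max a b

variable {L : Type*} [Field L] {w : AbsoluteValue L ℝ}

lemma apply_eval_le_one (hw : IsNonarchimedean w) {p : L[X]} (hp : ∀ n, w (p.coeff n) ≤ 1) {a : L}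
    (ha : w a ≤ 1) : w (p.eval a) ≤ 1 := by
  obtain ⟨q, rfl⟩ := (mem_lifts _).1 (mem_lifts_integerSubring (hw := hw).2 hp)
  have : (q.map (integerSubring hw).subtype).eval a =
      (integerSubring hw).subtype (q.eval ⟨a, ha⟩) :=
    eval_map_apply (integerSubring hw).subtype (⟨a, ha⟩ : integerSubring hw)
  rw [this]
  exact (q.eval ⟨a, ha⟩).2

/-- `a - b` divides `p(a) - p(b)` over the ring of integers. -/
lemma apply_eval_sub_eval_le (hw : IsNonarchimedean w) {p : L[X]} (hp : ∀ n, w (p.coeff n) ≤ 1)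
    {a b : L} (ha : w a ≤ 1) (hb : w b ≤ 1) : w (p.eval a - p.eval b) ≤ w (a - b) := by
  obtain ⟨q, rfl⟩ := (mem_lifts _).1 (mem_lifts_integerSubring (hw := hw).2 hp)
  obtain ⟨c, hc⟩ := sub_dvd_eval_sub (⟨a, ha⟩ : integerSubring hw) ⟨b, hb⟩ q
  have h1 : ∀ z : integerSubring hw, (q.map (integerSubring hw).subtype).eval (z : L) =
      (q.eval z : integerSubring hw) := fun z => eval_map_apply (integerSubring hw).subtype z
  have h2 := h1 ⟨a, ha⟩
  have h3 := h1 ⟨b, hb⟩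
  have h4 : (((q.eval ⟨a, ha⟩ - q.eval ⟨b, hb⟩ : integerSubring hw)) : L) = (a - b) * c := by
    rw [hc]; rfl
  simp only at h2 h3
  rw [h2, h3, ← AddSubgroupClass.coe_sub, h4, w.map_mul]
  exact mul_le_of_le_one_right (w.nonneg _) c.2

/-- At an argument of absolute value above one the leading term would dominate all others. -/
lemma apply_root_le_one (hw : IsNonarchimedean w) {p : L[X]} (hp : ∀ n, w (p.coeff n) ≤ 1)
    (hlc : w p.leadingCoeff = 1) {a : L} (ha : p.IsRoot a) : w a ≤ 1 := by
  by_contra! hgt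
  have h0 : ∑ i ∈ Finset.range p.natDegree, p.coeff i * a ^ i + p.leadingCoeff * a ^ p.natDegree
      = 0 := by
    rw [leadingCoeff, ← Finset.sum_range_succ, ← eval_eq_sum_range]; exact ha
  have hn : p.natDegree ≠ 0 := by
    intro h
    rw [h] at h0
    rw [Finset.sum_range_zero, zero_add, pow_zero, mul_one] at h0
    rw [h0, w.map_zero] at hlc
    exact zero_ne_one hlc
  have h1 : w (∑ i ∈ Finset.range p.natDegree, p.coeff i * a ^ i) ≤ w a ^ (p.natDegree - 1) := by
    refine apply_sum_le_of_isNonarchimedean hw _ _ (by positivity) fun i hi => ?_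
    rw [w.map_mul, w.map_pow]
    refine (mul_le_of_le_one_left (by positivity) (hp i)).trans ?_
    exact pow_le_pow_right₀ hgt.le (by have := Finset.mem_range.1 hi; omega)
  rw [eq_neg_of_add_eq_zero_left h0, w.map_neg, w.map_mul, hlc, one_mul, w.map_pow] at h1
  exact absurd h1 (not_le.2 (pow_lt_pow_right₀ hgt (by omega)))

lemma apply_multiset_prod_le_one {S : Multiset L} (hS : ∀ a ∈ S, w a ≤ 1) : w S.prod ≤ 1 := by
  induction S using Multiset.induction_on with
  | empty => simp
  | cons b S ih =>
    rw [Multiset.prod_cons, w.map_mul]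
    exact mul_le_one₀ (hS b (Multiset.mem_cons_self _ _)) (w.nonneg _)
      (ih fun a ha => hS a (Multiset.mem_cons_of_mem ha))

lemma apply_multiset_prod_lt_one {S : Multiset L} (hS : ∀ a ∈ S, w a ≤ 1) {a : L} (ha : a ∈ S)
    (ha1 : w a < 1) : w S.prod < 1 := by
  obtain ⟨T, rfl⟩ := Multiset.exists_cons_of_mem ha
  rw [Multiset.prod_cons, w.map_mul]
  exact mul_lt_one_of_nonneg_of_lt_one_left (w.nonneg _) ha1
    (apply_multiset_prod_le_one fun b hb => hS b (Multiset.mem_cons_of_mem hb))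

/-- If two distinct roots of `p` are close, the resultant of `p` and its derivative is small. -/
lemma apply_resultant_derivative_lt_one (hw : IsNonarchimedean w) {p : L[X]} (hsplit : p.Splits)
    (hlc : w p.leadingCoeff ≤ 1) (hroot : ∀ a, p.IsRoot a → w a ≤ 1) {a b : L}
    (ha : p.IsRoot a) (hb : p.IsRoot b) (hab : a ≠ b) (hclose : w (a - b) < 1) (n : ℕ)
    (hn : p.derivative.natDegree ≤ n) :
    w (resultant p p.derivative p.natDegree n) < 1 := by
  -- If `p = 0`, every element is a root, but `(a - b)⁻¹` is not integral.
  have hp0 : p ≠ 0 := by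
    rintro rfl
    have hall : ∀ c : L, w c ≤ 1 := fun c => hroot c (by simp)
    have h1 := hall (a - b)⁻¹
    rw [map_inv₀] at h1
    have hpos : 0 < w (a - b) := w.pos (sub_ne_zero.2 hab)
    exact absurd h1 (not_le.2 ((one_lt_inv₀ hpos).2 hclose))
  have hint : ∀ S : Multiset L, (∀ c ∈ S, w c ≤ 1) → ∀ n, w ((C p.leadingCoeff *
      (S.map (fun c => X - C c)).prod).coeff n) ≤ 1 := by
    intro S hS
    rw [← mem_lifts_integerSubring (hw := hw)]
    have hC : ∀ c : L, w c ≤ 1 → (C c : L[X]) ∈ lifts (integerSubring hw).subtype :=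
      fun c hc => C_mem_lifts (integerSubring hw).subtype ⟨c, hc⟩
    refine mul_mem (hC _ hlc) (multiset_prod_mem _ fun q hq => ?_)
    obtain ⟨c, hc, rfl⟩ := Multiset.mem_map.1 hq
    rw [sub_eq_add_neg, ← C_neg]
    exact add_mem (X_mem_lifts _) (hC _ (by rw [w.map_neg]; exact hS c hc))
  have hmem : ∀ c ∈ p.roots, w c ≤ 1 := fun c hc => hroot c (isRoot_of_mem_roots hc)
  have hpint : ∀ n, w (p.coeff n) ≤ 1 := by
    have := hint p.roots hmem
    rwa [← hsplit.eq_prod_roots] at this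
  have hder : ∀ n, w (p.derivative.coeff n) ≤ 1 := by
    rw [← mem_lifts_integerSubring (hw := hw)]
    obtain ⟨q, hq⟩ := (mem_lifts _).1 (mem_lifts_integerSubring (hw := hw).2 hpint)
    exact (mem_lifts _).2 ⟨q.derivative, by rw [← derivative_map, hq]⟩
  -- `p'(a)` is `a - b` times an integral factor, and it is one factor of the resultant, a product
  -- over the roots.
  have hda : w (p.derivative.eval a) < 1 := by
    obtain ⟨S, hS⟩ := Multiset.exists_cons_of_mem ((mem_roots hp0).2 ha)
    have hbS : b ∈ S := by
      have : b ∈ a ::ₘ S := hS ▸ (mem_roots hp0).2 hb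
      exact (Multiset.mem_cons.1 this).resolve_left hab.symm
    obtain ⟨T, rfl⟩ := Multiset.exists_cons_of_mem hbS
    have hp : p = (X - C a) * ((X - C b) * (C p.leadingCoeff *
        (T.map (fun c => X - C c)).prod)) := by
      conv_lhs => rw [hsplit.eq_prod_roots, hS, Multiset.map_cons, Multiset.map_cons,
        Multiset.prod_cons, Multiset.prod_cons]
      ring
    have hev : p.derivative.eval a = (a - b) * (C p.leadingCoeff *
        (T.map (fun c => X - C c)).prod).eval a := by
      conv_lhs => rw [hp]
      simp [derivative_mul]
    rw [hev, w.map_mul]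
    refine mul_lt_one_of_nonneg_of_lt_one_left (w.nonneg _) hclose
      (apply_eval_le_one hw (hint T fun c hc => hmem c ?_) (hroot a ha))
    rw [hS]
    exact Multiset.mem_cons_of_mem (Multiset.mem_cons_of_mem hc)
  rw [resultant_eq_prod_eval p p.derivative n hn hsplit, w.map_mul, w.map_pow]
  refine mul_lt_one_of_nonneg_of_lt_one_right (pow_le_one₀ (w.nonneg _) hlc) (w.nonneg _) ?_
  refine apply_multiset_prod_lt_one ?_ (Multiset.mem_map_of_mem _ ((mem_roots hp0).2 ha)) hda
  intro c hc
  obtain ⟨d, hd, rfl⟩ := Multiset.mem_map.1 hc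
  exact apply_eval_le_one hw hder (hmem d hd)

variable {K : Type*} [Field K]

/-- `f` lifts to the ring of integers, and resultants commute with ring homomorphisms once the
formal degrees are fixed. -/
lemma apply_coeff_resultantY_le_one {v : AbsoluteValue K ℝ} (hv : IsNonarchimedean v)
    {f : K[X][X]} (hf : ∀ i j, v ((f.coeff i).coeff j) ≤ 1) (j : ℕ) :
    v ((resultantY f).coeff j) ≤ 1 := by
  have h1 : f ∈ lifts (mapRingHom (integerSubring hv).subtype) := by
    rw [lifts_iff_coeff_lifts]
    intro i
    obtain ⟨q, hq⟩ := (mem_lifts _).1 (mem_lifts_integerSubring (hw := hv).2 (hf i))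
    exact ⟨q, hq⟩
  obtain ⟨q, rfl⟩ := (mem_lifts _).1 h1
  revert j
  rw [← mem_lifts_integerSubring (hw := hv), mem_lifts]
  refine ⟨resultant q q.derivative (q.map (mapRingHom (integerSubring hv).subtype)).natDegree
    (q.map (mapRingHom (integerSubring hv).subtype)).derivative.natDegree, ?_⟩
  rw [resultantY, derivative_map, resultant_map_map]
  rfl

lemma aeval_polyRadical [Algebra K L] [Algebra.IsAlgebraic K L] {p : K[X]} (hp : p ≠ 0) (a : L) :
    aeval a (polyRadical p) = 0 ↔ aeval a p = 0 := by
  classical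
  have hirr := minpoly.irreducible (Algebra.IsIntegral.isIntegral (R := K) a)
  rw [← minpoly.dvd_iff, ← minpoly.dvd_iff, polyRadical,
    IsUnit.dvd_mul_left (isUnit_C.2 (isUnit_iff_ne_zero.2 (leadingCoeff_ne_zero.2 hp)))]
  exact UniqueFactorizationMonoid.dvd_radical_iff_of_irreducible hirr hp

lemma leadingCoeff_polyRadical {p : K[X]} :
    (polyRadical p).leadingCoeff = p.leadingCoeff := by
  classical
  rw [polyRadical, leadingCoeff_mul, leadingCoeff_C]
  have : (UniqueFactorizationMonoid.radical p).Monic := by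
    refine monic_prod_of_monic _ _ fun q hq => ?_
    rw [UniqueFactorizationMonoid.mem_primeFactors] at hq
    have h := UniqueFactorizationMonoid.normalize_normalized_factor q hq
    have hq0 : q ≠ 0 := (UniqueFactorizationMonoid.irreducible_of_normalized_factor q hq).ne_zero
    rw [← h]
    exact monic_normalize hq0
  convert mul_one _
  exact this

/-- Outside the exceptional places, distinct critical values are not close to each other. -/
lemma one_le_sub_of_aeval_resultantY_eq_zero [Algebra K L] [IsAlgClosure K L]
    {v : AbsoluteValue K ℝ} (hv : IsFinitePlace v) (hwv : Extends w v) {f : K[X][X]}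
    (h₂ : v ∉ T₂ f) (h₃ : v ∉ T₃ f) (h₄ : v ∉ T₄ f) {a b : L}
    (ha : aeval a (resultantY f) = 0) (hb : aeval b (resultantY f) = 0) (hab : a ≠ b) :
    1 ≤ w (a - b) := by
  have : IsAlgClosed L := IsAlgClosure.isAlgClosed K
  have : Algebra.IsAlgebraic K L := IsAlgClosure.isAlgebraic
  by_contra! hclose
  apply h₄
  refine ⟨hv, ?_⟩
  have hw := hwv.isNonarchimedean hv.1
  have hf : ∀ i j, v ((f.coeff i).coeff j) ≤ 1 := by
    intro i j
    by_contra! h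
    exact h₂ ⟨hv, i, j, h⟩
  -- Outside `T₂` and `T₃`, `R` is integral with leading coefficient of absolute value one, so its
  -- roots are integral; two close ones would put `v` in `T₄`.
  have hR := apply_coeff_resultantY_le_one hv.1 hf
  have hlc : v (resultantY f).leadingCoeff = 1 := by
    refine le_antisymm (hR _) ?_
    by_contra! h
    exact h₃ ⟨hv, h⟩
  have hR0 : resultantY f ≠ 0 := by
    intro h
    rw [h, leadingCoeff_zero, v.map_zero] at hlc
    exact zero_ne_one hlc
  set g := polyRadical (resultantY f) with hg
  have hroot : ∀ c : L, (g.map (algebraMap K L)).IsRoot c ↔ aeval c (resultantY f) = 0 := by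
    intro c
    rw [IsRoot, eval_map_algebraMap, hg, aeval_polyRadical hR0]
  have key := apply_resultant_derivative_lt_one hw (p := g.map (algebraMap K L))
    (IsAlgClosed.splits _) (by rw [leadingCoeff_map, hwv, hg, leadingCoeff_polyRadical, hlc])
    (fun c hc => by
      refine apply_root_le_one hw (p := (resultantY f).map (algebraMap K L)) ?_ ?_ ?_
      · intro n
        rw [coeff_map, hwv]; exact hR n
      · rw [leadingCoeff_map, hwv, hlc]
      · rw [IsRoot, eval_map_algebraMap]; exact (hroot c).1 hc)
    ((hroot a).2 ha) ((hroot b).2 hb) hab hclose g.derivative.natDegree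
    (by rw [derivative_map]; exact natDegree_map_le)
  rwa [derivative_map, natDegree_map, resultant_map_map, hwv] at key

/-- The resultant is `± f₀` times the discriminant. Thus the roots of `f₀` are critical values. -/
lemma leadingCoeff_dvd_resultantY [CharZero K] {f : K[X][X]} (hf : 0 < f.natDegree) :
    f.leadingCoeff ∣ resultantY f := by
  have := resultant_deriv (natDegree_pos_iff_degree_pos.1 hf)
  rw [← natDegree_derivative f] at this
  rw [resultantY, this, mul_comm ((-1) ^ _), mul_assoc]
  exact dvd_mul_right _ _

/-- Every non-zero polynomial is the product of a polynomial all of whose factors divide `g`, and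
of a monic polynomial coprime to `g`. -/
lemma exists_mul_eq_isCoprime {p : K[X]} (hp : p ≠ 0) (g : K[X]) :
    ∃ q r : K[X], p = q * r ∧ r.Monic ∧ IsCoprime g r ∧ ∀ M, Irreducible M → M ∣ q → M ∣ g := by
  induction hn : p.natDegree using Nat.strong_induction_on generalizing p with
  | _ n ih =>
    by_cases hc : IsCoprime g p
    · have hu : IsUnit (C p.leadingCoeff) :=
        isUnit_C.2 (isUnit_iff_ne_zero.2 (leadingCoeff_ne_zero.2 hp))
      refine ⟨C p.leadingCoeff, C p.leadingCoeff⁻¹ * p, ?_, ?_, ?_, ?_⟩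
      · rw [← mul_assoc, ← C_mul, mul_inv_cancel₀ (leadingCoeff_ne_zero.2 hp), C_1, one_mul]
      · rw [mul_comm]; exact monic_mul_leadingCoeff_inv hp
      · refine (isCoprime_mul_unit_left_right ?_ _ _).2 hc
        exact isUnit_C.2 (isUnit_iff_ne_zero.2 (inv_ne_zero (leadingCoeff_ne_zero.2 hp)))
      · intro M hM hdvd
        exact absurd (isUnit_of_dvd_unit hdvd hu) hM.not_isUnit
    · obtain ⟨M, hM, hMg, p', rfl⟩ : ∃ M, Irreducible M ∧ M ∣ g ∧ M ∣ p := by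
        by_contra! h
        exact hc (isCoprime_of_irreducible_dvd (fun h0 => hp h0.2) fun z hz h1 h2 => h z hz h1 h2)
      have hp' := right_ne_zero_of_mul hp
      obtain ⟨q, r, rfl, hr, hgr, hq⟩ := ih p'.natDegree (by
        rw [← hn, natDegree_mul hM.ne_zero hp']
        have := hM.natDegree_pos
        omega) hp' rfl
      refine ⟨M * q, r, by ring, hr, hgr, fun N hN hdvd => ?_⟩
      rcases hN.prime.dvd_or_dvd hdvd with h | h
      · exact ((hN.associated_of_dvd hM h).dvd).trans hMg
      · exact hq N hN h

/-- Outside the exceptional places, the roots of the leading coefficient of `f` are not close to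
the critical values attached to `g`. -/
lemma one_le_sub_of_notMem_towerPlaces [Algebra K L] [IsAlgClosure K L]
    {v : AbsoluteValue K ℝ} (hv : IsFinitePlace v) (hwv : Extends w v) {f g : K[X][X]}
    (hf : f.leadingCoeff.Monic) (hf₂ : v ∉ T₂ f) (hg₂ : v ∉ T₂ g) (hg₃ : v ∉ T₃ g)
    (hU : v ∉ towerPlaces L f g) {a b : L} (ha : aeval a (resultantY g) = 0)
    (haf : aeval a f.leadingCoeff ≠ 0) (hb : aeval b f.leadingCoeff = 0) :
    1 ≤ w (a - b) := by
  have : IsAlgClosed L := IsAlgClosure.isAlgClosed K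
  have : Algebra.IsAlgebraic K L := IsAlgClosure.isAlgebraic
  by_contra! hclose
  have hw := hwv.isNonarchimedean hv.1
  have hint : ∀ f : K[X][X], v ∉ T₂ f → ∀ i j, v ((f.coeff i).coeff j) ≤ 1 := by
    intro f hf i j
    by_contra! h
    exact hf ⟨hv, i, j, h⟩
  have hR := apply_coeff_resultantY_le_one hv.1 (hint g hg₂)
  have hlc : v (resultantY g).leadingCoeff = 1 := by
    refine le_antisymm (hR _) ?_
    by_contra! h
    exact hg₃ ⟨hv, h⟩
  have hR0 : resultantY g ≠ 0 := by
    intro h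
    rw [h, leadingCoeff_zero, v.map_zero] at hlc
    exact zero_ne_one hlc
  have hroot : ∀ c : L, aeval c (resultantY g) = 0 → w c ≤ 1 := by
    intro c hc
    refine apply_root_le_one hw (p := (resultantY g).map (algebraMap K L)) ?_ ?_ ?_
    · intro n
      rw [coeff_map, hwv]; exact hR n
    · rw [leadingCoeff_map, hwv, hlc]
    · rw [IsRoot, eval_map_algebraMap]; exact hc
  have hfL : ∀ n, w ((f.leadingCoeff.map (algebraMap K L)).coeff n) ≤ 1 := by
    intro n
    rw [coeff_map, hwv]; exact hint f hf₂ _ n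
  have hbL : (f.leadingCoeff.map (algebraMap K L)).eval b = 0 := by rwa [eval_map_algebraMap]
  have hb1 : w b ≤ 1 := by
    refine apply_root_le_one hw hfL ?_ hbL
    rw [leadingCoeff_map, hwv, hf.leadingCoeff, v.map_one]
  -- `|f₀(a)| = |f₀(a) - f₀(b)| ≤ |a - b|`.
  have hsmall : w ((f.leadingCoeff.map (algebraMap K L)).eval a) < 1 := by
    have := apply_eval_sub_eval_le hw hfL (hroot a ha) hb1
    rw [hbL, sub_zero] at this
    exact this.trans_lt hclose
  -- This is the factorization required by `towerPlaces`; as `f₀(a) ≠ 0`, `a` is a root of the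
  -- second factor.
  obtain ⟨q, r, hqr, hr, hcop, hq⟩ := exists_mul_eq_isCoprime hR0 f.leadingCoeff
  have hra : aeval a r = 0 := by
    rw [hqr, map_mul] at ha
    refine (mul_eq_zero.1 ha).resolve_left fun h => haf ?_
    exact (minpoly.dvd_iff).1 (hq _ (minpoly.irreducible (Algebra.IsIntegral.isIntegral a))
      (minpoly.dvd K a h))
  apply hU
  refine ⟨Or.inl hv, q, r, hqr, fun c hc => ?_, fun c hc h0 => ?_, hr, ?_⟩
  · exact (minpoly.dvd_iff).1 (hq _ (minpoly.irreducible (Algebra.IsIntegral.isIntegral c))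
      (minpoly.dvd K c hc))
  · obtain ⟨s, t, hst⟩ := hcop
    have := congrArg (aeval c) hst
    rw [map_add, map_mul, map_mul, h0, hc] at this
    simp at this
  -- Up to sign the resultant is the product of `f₀(d)` over the roots `d` of the monic `r`: all
  -- factors are integral, and the one at `a` is small.
  · rw [← hwv, ← resultant_map_map, resultant_comm, w.map_mul, w.map_pow, w.map_neg, w.map_one,
      one_pow, one_mul, ← natDegree_map (p := r) (algebraMap K L),
      resultant_eq_prod_eval _ _ _ natDegree_map_le (IsAlgClosed.splits _), w.map_mul,
      leadingCoeff_map, hr.leadingCoeff, map_one, one_pow, w.map_one, one_mul]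
    have hr0 : r.map (algebraMap K L) ≠ 0 := (hr.map _).ne_zero
    refine apply_multiset_prod_lt_one ?_ (Multiset.mem_map_of_mem _ ((mem_roots hr0).2 ?_)) hsmall
    · intro c hc
      obtain ⟨d, hd, rfl⟩ := Multiset.mem_map.1 hc
      refine apply_eval_le_one hw hfL (hroot d ?_)
      have := (isRoot_of_mem_roots hd)
      rw [IsRoot, eval_map_algebraMap] at this
      rw [hqr, map_mul, this, mul_zero]
    · rw [IsRoot, eval_map_algebraMap]; exact hra

end Separation

/-! ### Values at points, and images of points and expansions -/

section Points

variable {K F L : Type*} [Field K] [Field F] [Algebra K F] [Field L] [Algebra K L]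

lemma map_aevalAeval {A B : Type*} [CommRing A] [Algebra K A] [CommRing B] [Algebra K B]
    (φ : A →ₐ[K] B) (a b : A) (p : K[X][X]) :
    φ (aevalAeval a b p) = aevalAeval (φ a) (φ b) p := by
  induction p using Polynomial.induction_on' with
  | add p q hp hq => rw [map_add, map_add, hp, hq, map_add]
  | monomial n c =>
    rw [← C_mul_X_pow_eq_monomial]
    simp only [map_mul, map_pow, aevalAeval_C, aevalAeval_Y]
    rw [← aeval_algHom_apply]

namespace CurvePoint

variable {P : CurvePoint K F L} {g h : F} {a b : L}

lemma HasValue.unique (h₁ : P.HasValue g a) (h₂ : P.HasValue g b) : a = b := by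
  obtain ⟨_, rfl⟩ := h₁
  obtain ⟨_, rfl⟩ := h₂
  rfl

lemma HasValue.mul (hg : P.HasValue g a) (hh : P.HasValue h b) : P.HasValue (g * h) (a * b) := by
  obtain ⟨hg, rfl⟩ := hg
  obtain ⟨hh, rfl⟩ := hh
  exact ⟨mul_mem hg hh, map_mul P.eval ⟨g, hg⟩ ⟨h, hh⟩⟩

lemma HasValue.aeval (hg : P.HasValue g a) (p : K[X]) :
    P.HasValue (aeval g p) (aeval a p) := by
  obtain ⟨hg, rfl⟩ := hg
  have h1 : Polynomial.aeval g p = P.localRing.val (Polynomial.aeval ⟨g, hg⟩ p) :=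
    (aeval_algHom_apply P.localRing.val (⟨g, hg⟩ : P.localRing) p)
  rw [h1]
  exact ⟨(Polynomial.aeval (⟨g, hg⟩ : P.localRing) p).2, (aeval_algHom_apply P.eval _ p).symm⟩

lemma HasValue.aevalAeval (hg : P.HasValue g a) (hh : P.HasValue h b) (p : K[X][X]) :
    P.HasValue (aevalAeval g h p) (aevalAeval a b p) := by
  obtain ⟨hg, rfl⟩ := hg
  obtain ⟨hh, rfl⟩ := hh
  have h1 : Polynomial.aevalAeval g h p =
      P.localRing.val (Polynomial.aevalAeval ⟨g, hg⟩ ⟨h, hh⟩ p) :=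
    (map_aevalAeval P.localRing.val ⟨g, hg⟩ ⟨h, hh⟩ p).symm
  rw [h1]
  exact ⟨(Polynomial.aevalAeval (⟨g, hg⟩ : P.localRing) ⟨h, hh⟩ p).2,
    map_aevalAeval P.eval ⟨g, hg⟩ ⟨h, hh⟩ p⟩

/-- A function with a non-zero value in `K` is invertible at the point. -/
lemma HasValue.inv {c : K} (hg : P.HasValue g (algebraMap K L c)) (hc : c ≠ 0) :
    P.HasValue g⁻¹ (algebraMap K L c)⁻¹ := by
  have hcL : algebraMap K L c ≠ 0 := (_root_.map_ne_zero _).2 hc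
  obtain ⟨hgm, hgv⟩ := hg
  have hg0 : g ≠ 0 := by
    rintro rfl
    exact hcL (hgv.symm.trans (map_zero P.eval))
  have hmem : g⁻¹ ∈ P.localRing := by
    by_contra hnot
    have hz0 : g - algebraMap K F c ≠ 0 := by
      intro h0
      apply hnot
      rw [sub_eq_zero.1 h0, ← map_inv₀]
      exact P.localRing.algebraMap_mem _
    -- If `(g - c) / g` is regular, so is `g⁻¹ = c⁻¹ (1 - (g - c) / g)`. If its inverse is, then `g`
    -- is a regular multiple of `g - c` and has value zero.
    rcases P.mem_or_inv_mem ((g - algebraMap K F c) / g) with h | h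
    · apply hnot
      have e : g⁻¹ = algebraMap K F c⁻¹ * (1 - (g - algebraMap K F c) / g) := by
        rw [map_inv₀]
        have := (_root_.map_ne_zero (algebraMap K F)).2 hc
        field_simp
        ring
      rw [e]
      exact mul_mem (P.localRing.algebraMap_mem _) (sub_mem (one_mem _) h)
    · have hsub : g - algebraMap K F c ∈ P.localRing :=
        sub_mem hgm (P.localRing.algebraMap_mem c)
      have e : (⟨g, hgm⟩ : P.localRing) =
          ⟨_, h⟩ * (⟨g, hgm⟩ - algebraMap K P.localRing c) := by
        ext
        change g = ((g - algebraMap K F c) / g)⁻¹ * (g - algebraMap K F c)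
        field_simp
      have h1 := congrArg P.eval e
      rw [map_mul, map_sub, hgv, AlgHom.commutes, sub_self, mul_zero] at h1
      exact hcL h1
  refine ⟨hmem, ?_⟩
  have e : (⟨g, hgm⟩ : P.localRing) * ⟨g⁻¹, hmem⟩ = 1 := by
    ext
    exact mul_inv_cancel₀ hg0
  have h1 := congrArg P.eval e
  rw [map_mul, hgv, map_one] at h1
  exact eq_inv_of_mul_eq_one_right h1

lemma hasValue_below_iff {Ft : Type*} [Field Ft] [Algebra K Ft] [Algebra F Ft]
    [IsScalarTower K F Ft] [FiniteDimensional F Ft] {P : CurvePoint K Ft L} :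
    (P.below F).HasValue g a ↔ P.HasValue (algebraMap F Ft g) a := Iff.rfl

end CurvePoint

lemma HasBoundedValue.aevalAeval {w : AbsoluteValue L ℝ} {hw : IsNonarchimedean w} {τ : L}
    {ρ : F →+* LaurentSeries L}
    (hρ : ∀ c : K, ρ (algebraMap K F c) = HahnSeries.C (algebraMap K L c)) {g h : F} {a b : L}
    (hg : HasBoundedValue hw τ (ρ g) a) (hh : HasBoundedValue hw τ (ρ h) b) (p : K[X][X]) :
    HasBoundedValue hw τ (ρ (aevalAeval g h p)) (aevalAeval a b p) := by
  have haeval : ∀ p : K[X], HasBoundedValue hw τ (ρ (aeval g p)) (aeval a p) := by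
    intro p
    induction p using Polynomial.induction_on' with
    | add p q hp hq => rw [map_add, map_add, map_add]; exact hp.add hq
    | monomial n c =>
      rw [aeval_monomial, aeval_monomial, map_mul, map_pow, hρ]
      exact (HasBoundedValue.const hw τ _).mul (hg.pow n)
  induction p using Polynomial.induction_on' with
  | add p q hp hq => rw [map_add, map_add, map_add]; exact hp.add hq
  | monomial n c =>
    rw [← C_mul_X_pow_eq_monomial]
    simp only [map_mul, map_pow, aevalAeval_C, aevalAeval_Y]
    exact (haeval c).mul (hh.pow n)

lemma partialSum_expandLaurent {m : ℕ} (hm : 0 < m) (s : LaurentSeries L) (τ : L) (N : ℕ) :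
    partialSum (expandLaurent m hm s) τ (m * N) = partialSum s (τ ^ m) N := by
  have hm' : (m : ℤ) ≠ 0 := by exact_mod_cast hm.ne'
  have hmpos : (0 : ℤ) < m := by exact_mod_cast hm
  rw [partialSum, partialSum, order_expandLaurent]
  symm
  refine Finset.sum_of_injOn (fun k : ℤ => (m : ℤ) * k) (fun a _ b _ h => mul_left_cancel₀ hm' h)
    ?_ ?_ ?_
  · intro k hk
    simp only [Finset.coe_Ico, Set.mem_Ico] at hk ⊢
    push_cast
    exact ⟨mul_le_mul_of_nonneg_left hk.1 hmpos.le, mul_lt_mul_of_pos_left hk.2 hmpos⟩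
  · intro j hj hj'
    have : ¬ (m : ℤ) ∣ j := by
      rintro ⟨k, rfl⟩
      apply hj'
      simp only [Finset.mem_Ico] at hj
      push_cast at hj
      refine ⟨k, ?_, rfl⟩
      simp only [Finset.coe_Ico, Set.mem_Ico]
      exact ⟨le_of_mul_le_mul_left hj.1 hmpos, lt_of_mul_lt_mul_left hj.2 hmpos.le⟩
    rw [coeff_expandLaurent_of_not_dvd s this, zero_mul]
  · intro k _
    rw [coeff_expandLaurent_mul, ← zpow_natCast τ m, ← zpow_mul]

/-- The partial sums of `s` at `τ^m` are a subsequence, at the indices `mN`, of those of `s(t^m)` at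
`τ`. -/
lemma SumsTo.of_expandLaurent {w : AbsoluteValue L ℝ} {m : ℕ} {hm : 0 < m} {s : LaurentSeries L}
    {τ c : L} (hτ : τ ≠ 0) (h : SumsTo w (expandLaurent m hm s) τ c) : SumsTo w s (τ ^ m) c := by
  refine ⟨fun h0 => absurd h0 (pow_ne_zero m hτ), ?_⟩
  have h1 : Filter.Tendsto (fun N : ℕ => m * N) Filter.atTop Filter.atTop :=
    Filter.tendsto_id.const_mul_atTop' hm
  refine (h.2.comp h1).congr fun N => ?_
  simp only [Function.comp_apply]
  rw [partialSum_expandLaurent]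

lemma eq_ofPowerSeries_of_coeff_neg {s : LaurentSeries L} (hs : ∀ k < 0, s.coeff k = 0) :
    s = HahnSeries.ofPowerSeries ℤ L (PowerSeries.mk fun n => s.coeff n) := by
  ext k
  rw [PowerSeries.coeff_coe]
  split_ifs with hk
  · exact hs k hk
  · rw [PowerSeries.coeff_mk, Int.natAbs_of_nonneg (not_lt.1 hk)]

/-- The Puiseux expansions at a point of a covering curve restrict to Puiseux expansions at the
image point. -/
lemma IsPuiseuxExpansion.exists_below [CharZero K] [Algebra.IsAlgebraic K L] {Ft : Type*}
    [Field Ft] [Algebra K Ft] [Algebra F Ft] [IsScalarTower K F Ft] [FiniteDimensional F Ft]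
    {x y : F} (hx : Transcendental K x) {f : K[X][X]} (hf : IsDefiningPolynomial x y f)
    (hxy : IntermediateField.adjoin K {x, y} = ⊤) {Q : CurvePoint K Ft L} {e : ℕ}
    {σ : Ft →+* LaurentSeries L} (hσ : IsPuiseuxExpansion (algebraMap F Ft x) Q e σ) :
    ∃ (m : ℕ) (hm : 0 < m) (d : ℕ) (σ' : F →+* LaurentSeries L), e = m * d ∧
      (∀ g, expandLaurent m hm (σ' g) = σ (algebraMap F Ft g)) ∧
      IsPuiseuxExpansion x (Q.below F) d σ' := by
  obtain ⟨he, hK, hreg, -, α, hα, hσx⟩ := hσ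
  obtain ⟨m, hm, d, σ', hd, hσ', hone⟩ := exists_expandLaurent_comp_eq hx hf hxy
    (ρ := σ.comp (algebraMap F Ft))
    (fun c => by rw [RingHom.comp_apply, ← IsScalarTower.algebraMap_apply, hK]) he hσx
  refine ⟨m, hm, d, σ', hd, hσ', ?_, fun c => ?_, fun g => ?_, hone, α, hα, ?_⟩
  · exact Nat.pos_of_mul_pos_left (hd ▸ he)
  · apply expandLaurent_injective (hm := hm)
    rw [hσ', expandLaurent_C, RingHom.comp_apply, ← IsScalarTower.algebraMap_apply, hK]
  · obtain ⟨s, hs, hs0⟩ := hreg ⟨algebraMap F Ft g, g.2⟩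
    have hcoeff : ∀ k, (σ' g).coeff k = (HahnSeries.ofPowerSeries ℤ L s).coeff (m * k) := fun k => by
      rw [← hs, ← coeff_expandLaurent_mul (hm := hm), hσ']
      rfl
    refine ⟨_, eq_ofPowerSeries_of_coeff_neg fun k hk => ?_, ?_⟩
    · rw [hcoeff]
      exact coeff_ofPowerSeries_of_neg s (mul_neg_of_pos_of_neg (by exact_mod_cast hm) hk)
    · rw [← PowerSeries.coeff_zero_eq_constantCoeff_apply, PowerSeries.coeff_mk, hcoeff,
        Nat.cast_zero, mul_zero, coeff_ofPowerSeries_zero, hs0]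
      rfl
  · apply expandLaurent_injective (hm := hm)
    rw [hσ', map_add, expandLaurent_C, expandLaurent_single, RingHom.comp_apply, hσx, hd]
    push_cast
    rfl

end Points

end CurveProximity

end

/-! ### The proposition -/

open CurveProximity
theorem mainTheorem9 {K Kbar F Ft : Type*}
    [Field K] [NumberField K] [Field Kbar] [Algebra K Kbar] [IsAlgClosure K Kbar]
    -- the two curves, given by their function fields, and the covering
    [Field F] [Algebra K F] [IsCurveFunctionField K F]
    (hirr : IsAbsolutelyIrreducible K Kbar F)
    [Field Ft] [Algebra K Ft] [IsCurveFunctionField K Ft]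
    [Algebra F Ft] [IsScalarTower K F Ft] [FiniteDimensional F Ft]
    -- the functions and the defining polynomials
    (x y : F) (hx : Transcendental K x) (hxy : IntermediateField.adjoin K {x, y} = ⊤)
    (f : Polynomial (Polynomial K)) (hf : IsDefiningPolynomial x y f)
    (yt : Ft) (hxyt : IntermediateField.adjoin K {algebraMap F Ft x, yt} = ⊤)
    (ft : Polynomial (Polynomial K)) (hft : IsDefiningPolynomial (algebraMap F Ft x) yt ft)
    -- the points
    (P : CurvePoint K F Kbar) (ξ : K) (hξ : P.HasValue x (algebraMap K Kbar ξ))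
    (Pt : CurvePoint K Ft Kbar) (hPt : Pt.below F = P)
    (Qt : CurvePoint K Ft Kbar) (hQt : Qt ∈ criticalPoints Kbar (algebraMap F Ft x) ft)
    (hne : ¬ Qt.HasValue (algebraMap F Ft x) (algebraMap K Kbar ξ))
    -- the places
    (v : AbsoluteValue K ℝ) (hv : IsFinitePlace v)
    (vbar : AbsoluteValue Kbar ℝ) (hvbar : Extends vbar v)
    (hclose : IsClose vbar (algebraMap F Ft x) yt Pt Qt) :
    1 < v ξ ∨
    v ∈ exceptionalPlaces Kbar x y f ∪ exceptionalPlaces Kbar (algebraMap F Ft x) yt ft ∪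
      towerPlaces Kbar f ft ∨
    IsClose vbar x y P (Qt.below F) := by
  have : Algebra.IsAlgebraic K Kbar := IsAlgClosure.isAlgebraic
  have : IsAlgClosed Kbar := IsAlgClosure.isAlgClosed K
  refine Or.inr (or_iff_not_imp_left.2 fun hexc => ?_)
  simp only [exceptionalPlaces, Set.mem_union, not_or] at hexc
  obtain ⟨⟨⟨⟨⟨⟨⟨⟨-, hT₂⟩, hT₃⟩, hT₄⟩, -⟩, -⟩, -⟩,
    ⟨⟨⟨⟨⟨⟨-, hTt₂⟩, hTt₃⟩, hTt₄⟩, hTt₅⟩, -⟩, -⟩⟩, hU⟩ := hexc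
  subst hPt
  have hw := hvbar.isNonarchimedean hv.1
  have hxt : Transcendental K (algebraMap F Ft x) :=
    (transcendental_algebraMap_iff (algebraMap F Ft).injective).2 hx
  have hyt : Polynomial.aevalAeval (algebraMap F Ft x) (algebraMap F Ft y) f = 0 := by
    have := map_aevalAeval (IsScalarTower.toAlgHom K F Ft) x y f
    rw [hf.2.1, map_zero] at this
    exact this.symm
  obtain ⟨ξ', α, hξ', hα, hξα, e, σt, ζ, τ, hσt, hζ, hτ, hall, i, hi, η, hη, hsum⟩ := hclose
  obtain rfl : algebraMap K Kbar ξ = ξ' := hξ.unique hξ'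
  have hRα : Polynomial.aeval α (resultantY ft) = 0 := by
    obtain ⟨α', hα', h⟩ := hQt
    rwa [hα.unique hα']
  have hξα0 : algebraMap K Kbar ξ - α ≠ 0 := fun h => hne (sub_eq_zero.1 h ▸ hα)
  obtain ⟨B, A, hB0, hBA, hB⟩ := hft.exists_denominator hxt hxyt hyt
  have hsep : ∀ β : Kbar, Polynomial.aeval β B = 0 → β ≠ α → 1 ≤ vbar (α - β) := by
    intro β hβ hβα
    rcases hB _ (minpoly.irreducible (Algebra.IsIntegral.isIntegral β)) (minpoly.dvd K β hβ)
      with h | h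
    · rw [minpoly.dvd_iff] at h
      have hdvd := leadingCoeff_dvd_resultantY (hf.natDegree_pos hx)
      have hroot : ∀ γ : Kbar, Polynomial.aeval γ f.leadingCoeff = 0 →
          Polynomial.aeval γ (resultantY f) = 0 := fun γ hγ =>
        Polynomial.aeval_eq_zero_of_dvd_aeval_eq_zero hdvd hγ
      -- Here `f₀(β) = 0`. If also `f₀(α) = 0`, both are critical values for `f`; otherwise `U`
      -- separates `α` from the roots of `f₀`.
      by_cases hfα : Polynomial.aeval α f.leadingCoeff = 0
      · exact one_le_sub_of_aeval_resultantY_eq_zero hv hvbar hT₂ hT₃ hT₄ (hroot α hfα)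
          (hroot β h) hβα.symm
      · exact one_le_sub_of_notMem_towerPlaces hv hvbar hf.2.2 hT₂ hTt₂ hTt₃ hU hRα hfα h
    · exact one_le_sub_of_aeval_resultantY_eq_zero hv hvbar hTt₂ hTt₃ hTt₄ hRα
        ((minpoly.dvd_iff).1 h) hβα.symm
  -- `ξ ≠ α` is too close to `α` to be a root of `B`.
  have hBξL : Polynomial.aeval (algebraMap K Kbar ξ) B ≠ 0 := by
    intro h
    have := hsep _ h (sub_ne_zero.1 hξα0)
    rw [← vbar.map_neg, neg_sub] at this
    exact absurd hξα (not_lt.2 this)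
  have hBξ_eq : Polynomial.aeval (algebraMap K Kbar ξ) B = algebraMap K Kbar (B.eval ξ) := by
    rw [Polynomial.aeval_algebraMap_apply, Polynomial.coe_aeval_eq_eval]
  have hBx0 : Polynomial.aeval (algebraMap F Ft x) B ≠ 0 :=
    aeval_ne_zero_of_transcendental hxt hB0
  have hy_eq : algebraMap F Ft y = Polynomial.aevalAeval (algebraMap F Ft x) yt A *
      (Polynomial.aeval (algebraMap F Ft x) B)⁻¹ := by
    rw [← hBA, mul_comm (Polynomial.aeval _ B), mul_assoc, mul_inv_cancel₀ hBx0, mul_one]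
  obtain ⟨he, hK, -, -, α', hα', hσx⟩ := id hσt
  obtain rfl : α = α' := hα.unique hα'
  have hvalue : ∀ (j : ℕ) (c : Kbar), SumsTo vbar (σt yt) (ζ ^ j * τ) c →
      SumsTo vbar (σt (algebraMap F Ft y)) (ζ ^ j * τ)
        (Polynomial.aevalAeval (algebraMap K Kbar ξ) c A *
          (Polynomial.aeval (algebraMap K Kbar ξ) B)⁻¹) := by
    intro j c hc
    have hpow : (ζ ^ j * τ) ^ e = algebraMap K Kbar ξ - α := by
      rw [mul_pow, ← pow_mul, mul_comm j, pow_mul, hζ.pow_eq_one, one_pow, one_mul, hτ]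
    have hτ0 : ζ ^ j * τ ≠ 0 := by
      intro h
      rw [h, zero_pow he.ne'] at hpow
      exact hξα0 hpow.symm
    have hτ1 : vbar (ζ ^ j * τ) < 1 := by
      rw [← hpow, vbar.map_pow] at hξα
      exact (pow_lt_one_iff_of_nonneg (vbar.nonneg _) he.ne').1 hξα
    have hyb : σt yt ∈ boundedSeries hw := by
      refine ⟨1, fun k => ?_⟩
      by_contra! h
      exact hTt₅ ⟨hv, Qt, hQt, e, σt, hσt, k, vbar, hvbar, h⟩
    have h1 := hc.hasBoundedValue hw hyb hτ0 hτ1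
    -- `x = α + t^e`, and `(ζ^j τ)^e = ξ - α`.
    have h2 : HasBoundedValue hw (ζ ^ j * τ) (σt (algebraMap F Ft x)) (algebraMap K Kbar ξ) := by
      have := (HasBoundedValue.const hw (ζ ^ j * τ) α).add
        ((HasBoundedValue.variable_self hw (ζ ^ j * τ)).pow e)
      rw [hpow, add_sub_cancel, HahnSeries.single_pow, one_pow, nsmul_one] at this
      rw [hσx]
      exact this
    have h3 := h2.aevalAeval hK h1 A
    have h4 := h2.aevalAeval hK h1 (Polynomial.C B)
    rw [Polynomial.aevalAeval_C, Polynomial.aevalAeval_C] at h4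
    have h5 : (σt (Polynomial.aeval (algebraMap F Ft x) B))⁻¹ ∈ boundedSeries hw := by
      rw [map_aeval_eq_eval₂ hK, hσx]
      refine inv_eval₂_mem_boundedSeries hw he fun β hβ hβα => hsep β ?_ hβα
      rwa [Polynomial.IsRoot, Polynomial.eval_map_algebraMap] at hβ
    have h6 := h3.mul (h4.inv h5 ((map_ne_zero σt).2 hBx0) hBξL)
    rw [← map_inv₀, ← map_mul, ← hy_eq] at h6
    exact h6.sumsTo hτ0 hτ1
  -- Since `ξ ∈ K`, the value `B(ξ)` is a non-zero element of `K`, so `B(x)` is invertible at `P̃`.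
  have hyP : (Pt.below F).HasValue y (Polynomial.aevalAeval (algebraMap K Kbar ξ) η A *
      (Polynomial.aeval (algebraMap K Kbar ξ) B)⁻¹) := by
    rw [CurvePoint.hasValue_below_iff, hy_eq]
    have h1 := hξ'.aeval B
    rw [hBξ_eq] at h1 hBξL ⊢
    exact (hξ'.aevalAeval hη A).mul (h1.inv fun h0 => hBξL (by rw [h0, map_zero]))
  obtain ⟨m, hm, d, σ, hd, hσ, hPu⟩ := hσt.exists_below hx hf hxy
  have hτ0 : τ ≠ 0 := by
    rintro rfl
    rw [zero_pow he.ne'] at hτ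
    exact hξα0 hτ.symm
  have hζ0 : ζ ≠ 0 := hζ.ne_zero he.ne'
  have hζm : IsPrimitiveRoot (ζ ^ m) d := hζ.pow he hd
  have hsum' : ∀ (j : ℕ) (c : Kbar), SumsTo vbar (σt yt) (ζ ^ j * τ) c →
      SumsTo vbar (σ y) ((ζ ^ m) ^ j * τ ^ m)
        (Polynomial.aevalAeval (algebraMap K Kbar ξ) c A *
          (Polynomial.aeval (algebraMap K Kbar ξ) B)⁻¹) := by
    intro j c hc
    have h1 := hvalue j c hc
    rw [← hσ] at h1
    have h2 := h1.of_expandLaurent (mul_ne_zero (pow_ne_zero _ hζ0) hτ0)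
    rwa [mul_pow, ← pow_mul, mul_comm j, pow_mul] at h2
  refine ⟨algebraMap K Kbar ξ, α, hξ, hα, hξα, d, σ, ζ ^ m, τ ^ m, hPu, hζm, ?_, ?_, ?_⟩
  · rw [← pow_mul, ← hd, hτ]
  · intro j hj
    obtain ⟨c, hc⟩ := hall j (hj.trans_le (by rw [hd]; exact Nat.le_mul_of_pos_left d hm))
    exact ⟨_, hsum' j c hc⟩
  -- The index `i < e` may exceed `d`, but `(ζ^m)^i` depends only on `i` modulo `d`.
  · refine ⟨i % d, Nat.mod_lt _ hPu.1, _, hyP, ?_⟩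
    rw [← pow_eq_pow_mod i hζm.pow_eq_one]
    exact hsum' i η hsum
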